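/- All vector spaces are finite-dimensional over $\mathbb{C}$. A Leibniz algebra is a vector space with a bilinear bracket satisfying $[x,[y,z]]=[[x,y],z]-[[x,z],y]$; its nilradical is its maximal nilpotent (two-sided) ideal. For odd $n\ge 5$ let $g^1_{(n,1)}$ be the $n$-dimensional Lie algebra with basis $e_1,\dots,e_n$ and $$[e_1,e_i]=e_{i+1}\ (2\le i\le n-2),\qquad [e_i,e_{n-i}]=(-1)^ie_n\ \left(2\le i\le \tfrac{n-1}{2}\right),$$ where the remaining products follow from antisymmetry or are zero. Theorem. Let $n>5$ be odd and let $R$ be a solvable Leibniz algebra whose nilradical $N$ is isomorphic to $g^1_{(n,1)}$ and has a one-dimensional complementary subspace in $R$. Then $R$ has a basis $\{e_1,\dots,e_n,x\}$ in which the products $[e_i,e_j]$ are those of $g^1_{(n,1)}$ above and the products involving $x$ are given by one of the following seven tables, with complex parameters (products involving $x$ that are not listed are zero): $R_1(a_2,b_5,\dots,b_{n-1})$: $$\begin{cases} [e_1,x]=-[x,e_1]=a_2e_2,\\ [e_i,x]=-[x,e_i]=e_i+\sum_{t=i+2}^{n-1}b_{t-i+2}e_t,& 2\le i\le n-2,\\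 [e_{n-1},x]=-[x,e_{n-1}]=e_{n-1}+a_2e_n,\\ [e_n,x]=-[x,e_n]=2e_n, \end{cases}$$ where $b_{2k}=0$ for $2\le k\le\frac{n-3}{2}$; $R_2(a_{n-1})$: $$\begin{cases} [e_1,x]=-[x,e_1]=e_1+a_{n-1}e_{n-1},\\ [e_i,x]=-[x,e_i]=(i+2-n)e_i,& 2\le i\le n-1,\\ [e_n,x]=-[x,e_n]=(4-n)e_n; \end{cases}$$ $R_3(\delta_{n-1})$: $$\begin{cases} [e_1,x]=-[x,e_1]=e_1,\\ [e_i,x]=-[x,e_i]=(i+1-n)e_i,& 2\le i\le n-2,\\ [e_n,x]=-[x,e_n]=(2-n)e_n,\\ [x,x]=\delta_{n-1}e_{n-1}; \end{cases}$$ $R_4(\delta_n)$: $$\begin{cases} [e_1,x]=-[x,e_1]=e_1,\\ [e_i,x]=-[x,e_i]=\left(i-\frac n2\right)e_i,& 2\le i\le n-1,\\ [x,x]=\delta_ne_n; \end{cases}$$ $R_5(a_n)$: $$\begin{cases} [e_1,x]=-[x,e_1]=e_1+a_ne_n,\\ [e_i,x]=-[x,e_i]=\left(i+\frac{1-n}{2}\right)e_i,&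 2\le i\le n-1,\\ [e_n,x]=-[x,e_n]=e_n; \end{cases}$$ $R_6(a_2)$: $$\begin{cases} [e_1,x]=-[x,e_1]=e_1+a_2e_2,\\ [e_i,x]=-[x,e_i]=(i-1)e_i,& 2\le i\le n-2,\\ [e_{n-1},x]=-[x,e_{n-1}]=(n-2)e_{n-1}+a_2e_n,\\ [e_n,x]=-[x,e_n]=(n-2)e_n; \end{cases}$$ $R_7(b_2)$, with $b_2\notin\left\{4-n,\ 3-n,\ \frac{4-n}{2},\ \frac{5-n}{2},\ 1\right\}$: $$\begin{cases} [e_1,x]=-[x,e_1]=e_1,\\ [e_i,x]=-[x,e_i]=(i-2+b_2)e_i,& 2\le i\le n-1,\\ [e_n,x]=-[x,e_n]=(n-4+2b_2)e_n. \end{cases}$$ -/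

import Mathlib

/-- A (right) Leibniz algebra over the complex numbers: a complex vector space with a bilinear
bracket such that `[x,[y,z]] = [[x,y],z] - [[x,z],y]`. -/
class LeibnizAlgebra (L : Type*) [AddCommGroup L] [Module ℂ L] where
  /-- the bilinear bracket -/
  br : L →ₗ[ℂ] L →ₗ[ℂ] L
  /-- the Leibniz identity -/
  leibniz : ∀ x y z : L, br x (br y z) = br (br x y) z - br (br x z) y

namespace LeibnizAlgebra

variable {L : Type*} [AddCommGroup L] [Module ℂ L] [LeibnizAlgebra L]

/-- Two-sided ideals. -/
def IsIdeal (I : Submodule ℂ L) : Prop :=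
  ∀ a ∈ I, ∀ y : L, br a y ∈ I ∧ br y a ∈ I

/-- The lower central series of a subspace `I` (used for ideals `I`, regarded as algebras):
`I, [I,I], [[I,I],I], …`, where `[A,B]` is the span of all brackets. -/
def lowerCentral (I : Submodule ℂ L) : ℕ → Submodule ℂ L
  | 0 => I
  | k + 1 => Submodule.map₂ br (lowerCentral I k) I

/-- The ideal `I`, regarded as an algebra, is nilpotent. -/
def IsNilpotentIdeal (I : Submodule ℂ L) : Prop :=
  ∃ k : ℕ, lowerCentral I k = ⊥

/-- The nilradical: the maximal nilpotent ideal. -/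
def IsNilradical (N : Submodule ℂ L) : Prop :=
  Maximal (fun I : Submodule ℂ L => IsIdeal I ∧ IsNilpotentIdeal I) N

variable (L) in
/-- The derived series of the algebra `L`. -/
def derived : ℕ → Submodule ℂ L
  | 0 => ⊤
  | k + 1 => Submodule.map₂ br (derived k) (derived k)

variable (L) in
/-- The algebra `L` is solvable. -/
def IsSolvableAlgebra : Prop :=
  ∃ k : ℕ, derived L k = ⊥

/-- The `i`-th vector of a basis, with the numbering starting at `1`
(and `0` for the indices outside `1, …, m`, which never occur in the tables below). -/
noncomputable def vec {V : Type*} [AddCommGroup V] [Module ℂ V] {m : ℕ}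
    (B : Module.Basis (Fin m) ℂ V) (i : ℕ) : V :=
  if h : 1 ≤ i ∧ i ≤ m then B ⟨i - 1, by omega⟩ else 0

/-- The product `[e_i, e_j]` in the multiplication table of the Lie algebra `g^1_{(n,1)}`:
`[e_1,e_i] = e_{i+1}` for `2 ≤ i ≤ n-2` and `[e_i,e_{n-i}] = (-1)^i e_n` for `2 ≤ i ≤ (n-1)/2`,
together with the products obtained by antisymmetry; all other products are zero. -/
def g1Product (n : ℕ) (e : ℕ → L) (i j : ℕ) : L :=
  if i = 1 ∧ 2 ≤ j ∧ j + 2 ≤ n then e (j + 1)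
  else if j = 1 ∧ 2 ≤ i ∧ i + 2 ≤ n then -e (i + 1)
  else if i + j = n ∧ 2 ≤ i ∧ 2 * i + 1 ≤ n then (-1 : ℂ) ^ i • e n
  else if i + j = n ∧ 2 ≤ j ∧ 2 * j + 1 ≤ n then -((-1 : ℂ) ^ j • e n)
  else 0

/-- The vectors `e_1, …, e_n` multiply according to the table of `g^1_{(n,1)}`. -/
def HasG1Table (n : ℕ) (e : ℕ → L) : Prop :=
  ∀ i j : ℕ, 1 ≤ i → i ≤ n → 1 ≤ j → j ≤ n → br (e i) (e j) = g1Product n e i j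

/-- The ideal `N`, regarded as an algebra, is (isomorphic to) `g^1_{(n,1)}`: it has a basis with
the multiplication table of that algebra. -/
def IsG1 (n : ℕ) (N : Submodule ℂ L) : Prop :=
  ∃ b : Module.Basis (Fin n) ℂ N, HasG1Table n (fun i => ((vec b i : N) : L))

/-- The complete multiplication table on `e_1, …, e_n, x`: the `e_i` multiply as in `g^1_{(n,1)}`,
and `[e_i,x] = -[x,e_i] = f i` for `1 ≤ i ≤ n`, `[x,x] = c`. -/
def HasTable (n : ℕ) (e : ℕ → L) (x : L) (f : ℕ → L) (c : L) : Prop :=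
  HasG1Table n e ∧
  (∀ i : ℕ, 1 ≤ i → i ≤ n → br (e i) x = f i ∧ br x (e i) = -f i) ∧
  br x x = c

/-- The table `R_1(a_2, b_5, …, b_{n-1})`. -/
def IsR1 (n : ℕ) (e : ℕ → L) (x : L) (a₂ : ℂ) (b : ℕ → ℂ) : Prop :=
  (∀ k : ℕ, 2 ≤ k → 2 * k + 3 ≤ n → b (2 * k) = 0) ∧
  HasTable n e x
    (fun i =>
      if i = 1 then a₂ • e 2
      else if i ≤ n - 2 then e i + ∑ t ∈ Finset.Icc (i + 2) (n - 1), b (t - i + 2) • e t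
      else if i = n - 1 then e (n - 1) + a₂ • e n
      else (2 : ℂ) • e n)
    0

/-- The table `R_2(a_{n-1})`. -/
def IsR2 (n : ℕ) (e : ℕ → L) (x : L) (a : ℂ) : Prop :=
  HasTable n e x
    (fun i =>
      if i = 1 then e 1 + a • e (n - 1)
      else if i ≤ n - 1 then ((i : ℂ) + 2 - n) • e i
      else (4 - (n : ℂ)) • e n)
    0

/-- The table `R_3(δ_{n-1})`. -/
def IsR3 (n : ℕ) (e : ℕ → L) (x : L) (δ : ℂ) : Prop :=
  HasTable n e x
    (fun i =>
      if i = 1 then e 1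
      else if i ≤ n - 2 then ((i : ℂ) + 1 - n) • e i
      else if i = n - 1 then 0
      else (2 - (n : ℂ)) • e n)
    (δ • e (n - 1))

/-- The table `R_4(δ_n)`. -/
def IsR4 (n : ℕ) (e : ℕ → L) (x : L) (δ : ℂ) : Prop :=
  HasTable n e x
    (fun i =>
      if i = 1 then e 1
      else if i ≤ n - 1 then ((i : ℂ) - n / 2) • e i
      else 0)
    (δ • e n)

/-- The table `R_5(a_n)`. -/
def IsR5 (n : ℕ) (e : ℕ → L) (x : L) (a : ℂ) : Prop :=
  HasTable n e x
    (fun i =>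
      if i = 1 then e 1 + a • e n
      else if i ≤ n - 1 then ((i : ℂ) + (1 - n) / 2) • e i
      else e n)
    0

/-- The table `R_6(a_2)`. -/
def IsR6 (n : ℕ) (e : ℕ → L) (x : L) (a₂ : ℂ) : Prop :=
  HasTable n e x
    (fun i =>
      if i = 1 then e 1 + a₂ • e 2
      else if i ≤ n - 2 then ((i : ℂ) - 1) • e i
      else if i = n - 1 then ((n : ℂ) - 2) • e (n - 1) + a₂ • e n
      else ((n : ℂ) - 2) • e n)
    0

/-- The table `R_7(b_2)`, with the excluded values of `b_2`. -/
def IsR7 (n : ℕ) (e : ℕ → L) (x : L) (b₂ : ℂ) : Prop :=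
  b₂ ∉ ({4 - (n : ℂ), 3 - (n : ℂ), (4 - (n : ℂ)) / 2, (5 - (n : ℂ)) / 2, 1} : Set ℂ) ∧
  HasTable n e x
    (fun i =>
      if i = 1 then e 1
      else if i ≤ n - 1 then ((i : ℂ) - 2 + b₂) • e i
      else ((n : ℂ) - 4 + 2 * b₂) • e n)
    0

end LeibnizAlgebra

/-! By the Leibniz identity, right multiplication `D = [·, x]` is a derivation of `N`, so it is
fixed by its values on the generators `e_1`, `e_2`. Modulo later basis vectors, `D e_1 = a e_1` and
`D e_2 = b e_2` (`derivation_two`). Hence `e_i` has weight `(i-2)a + b` for `2 ≤ i ≤ n-1`, and `e_n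
= [e_2, e_{n-2}]` is an eigenvector of weight `(n-4)a + 2b` (`derivation_apply`, `derivation_last`).
If `a = b = 0`, then `R` is nilpotent (`isNilpotentIdeal_top`), contradicting the maximality of `N`.
So `x` can be rescaled to `a = 1`, or to `a = 0`, `b = 1`.

If `a = 1`, the weights of `e_2, …, e_{n-1}` are distinct, so `e_2` can be made an eigenvector
modulo `e_n` (`exists_eigenframe`). Adding elements of `N` to `x` and shearing the basis then
removes every other off-diagonal term, except where two weights coincide: `b = 1`, `b = 4-n` and `b
= (5-n)/2` give the parameters of `R_6`, `R_2`, `R_5` (`exists_normalForm_one`). If `a = 0`, then `D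
e_2 = e_2 + ∑ β_t e_t`, and the even `β_t` with `4 ≤ t ≤ n-3` vanish because `D` respects `[e_2,
e_j] = 0`; this is `R_1`.

Left multiplication is then forced. The elements `[x,u] + [u,x]` with `u ∈ N`, and `[x,x]`, are
annihilated by all left multiplications, so they lie in the center `⟨e_{n-1}, e_n⟩` of `N`; there
`[x,·] = -[·,x]`, so they also lie in the kernel of `D`. The symmetric part vanishes
(`normalForm_one_swap` for `a = 1`). For `a = 1` the central weights are `n-3+b` and `n-4+2b`, so
`[x,x]` survives only for `b = 3-n` (`R_3`) or `b = (4-n)/2` (`R_4`); all other `b` give `R_7`. -/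

namespace LeibnizAlgebra

/-! ### The filtration by spans of final segments of a basis. -/

section TailSpan

variable {L : Type*} [AddCommGroup L] [Module ℂ L] {n i j : ℕ} {e : ℕ → L} {u v : L}

/-- The span of the vectors `e_i, …, e_n`. -/
def tailSpan (n : ℕ) (e : ℕ → L) (i : ℕ) : Submodule ℂ L :=
  Submodule.span ℂ (e '' Set.Icc i n)

lemma mem_tailSpan {t : ℕ} (h₁ : i ≤ t) (h₂ : t ≤ n) : e t ∈ tailSpan n e i :=
  Submodule.subset_span ⟨t, ⟨h₁, h₂⟩, rfl⟩

lemma tailSpan_le {S : Submodule ℂ L} (h : ∀ t, i ≤ t → t ≤ n → e t ∈ S) :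
    tailSpan n e i ≤ S := by
  refine Submodule.span_le.2 ?_
  rintro _ ⟨t, ht, rfl⟩
  exact h t ht.1 ht.2

lemma tailSpan_anti (h : i ≤ j) : tailSpan n e j ≤ tailSpan n e i :=
  tailSpan_le fun _ h₁ h₂ => mem_tailSpan (h.trans h₁) h₂

lemma tailSpan_eq_bot (h : n < i) : tailSpan n e i = ⊥ :=
  eq_bot_iff.2 (tailSpan_le fun _ h₁ h₂ => by omega)

lemma tailSpan_congr {e' : ℕ → L} (h : ∀ t, i ≤ t → t ≤ n → e t = e' t) :
    tailSpan n e i = tailSpan n e' i := by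
  unfold tailSpan
  congr 1
  exact Set.image_congr fun t ht => h t ht.1 ht.2

lemma exists_of_mem_tailSpan (hi : i ≤ n) (h : u ∈ tailSpan n e i) :
    ∃ c : ℂ, u - c • e i ∈ tailSpan n e (i + 1) := by
  have hs : e '' Set.Icc i n = insert (e i) (e '' Set.Icc (i + 1) n) := by
    rw [← Set.image_insert_eq]
    congr 1
    ext t
    simp only [Set.mem_Icc, Set.mem_insert_iff]
    omega
  rw [tailSpan, hs] at h
  obtain ⟨c, z, hz, rfl⟩ := Submodule.mem_span_insert.1 h
  exact ⟨c, by simpa [tailSpan] using hz⟩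

lemma exists_of_mem_tailSpan_self (h : u ∈ tailSpan n e n) : ∃ c : ℂ, u = c • e n := by
  obtain ⟨c, hc⟩ := exists_of_mem_tailSpan le_rfl h
  rw [tailSpan_eq_bot (Nat.lt_succ_self n), Submodule.mem_bot, sub_eq_zero] at hc
  exact ⟨c, hc⟩

lemma exists_of_mem_tailSpan_pred (hn : 1 ≤ n) (h : u ∈ tailSpan n e (n - 1)) :
    ∃ c d : ℂ, u = c • e (n - 1) + d • e n := by
  obtain ⟨c, hc⟩ := exists_of_mem_tailSpan (Nat.sub_le n 1) h
  rw [Nat.sub_add_cancel hn] at hc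
  obtain ⟨d, hd⟩ := exists_of_mem_tailSpan_self hc
  exact ⟨c, d, by rw [← hd]; abel⟩

variable [LeibnizAlgebra L]

lemma br_mem_of_mem_tailSpan {S : Submodule ℂ L}
    (h : ∀ s t, i ≤ s → s ≤ n → j ≤ t → t ≤ n → br (e s) (e t) ∈ S)
    (hu : u ∈ tailSpan n e i) (hv : v ∈ tailSpan n e j) : br u v ∈ S := by
  have h' : Submodule.map₂ br (tailSpan n e i) (tailSpan n e j) ≤ S := by
    rw [tailSpan, tailSpan, Submodule.map₂_span_span, Submodule.span_le]
    rintro _ ⟨_, ⟨s, hs, rfl⟩, _, ⟨t, ht, rfl⟩, rfl⟩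
    exact h s t hs.1 hs.2 ht.1 ht.2
  exact Submodule.map₂_le.1 h' u hu v hv

end TailSpan

/-! ### Triangular calculus inside `g^1_{(n,1)}`. -/

section Frame

variable {L : Type*} [AddCommGroup L] [Module ℂ L] [LeibnizAlgebra L]

/-- The vectors `e_1, …, e_n` form a basis of `N` that multiplies according to the table of
`g^1_{(n,1)}`. -/
structure G1Frame (n : ℕ) (N : Submodule ℂ L) (e : ℕ → L) : Prop where
  one_br : ∀ i, 2 ≤ i → i + 2 ≤ n → br (e 1) (e i) = e (i + 1)
  one_br_pred : br (e 1) (e (n - 1)) = 0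
  one_br_last : br (e 1) (e n) = 0
  br_add_eq : ∀ i j, 2 ≤ i → 2 ≤ j → i + j = n → br (e i) (e j) = (-1 : ℂ) ^ i • e n
  br_add_ne : ∀ i j, 2 ≤ i → i ≤ n → 2 ≤ j → j ≤ n → i + j ≠ n → br (e i) (e j) = 0
  anti : ∀ a ∈ N, ∀ b ∈ N, br a b = -br b a
  span_eq : tailSpan n e 1 = N
  notMem : ∀ i, 1 ≤ i → i ≤ n → e i ∉ tailSpan n e (i + 1)

namespace G1Frame

variable {n : ℕ} {N : Submodule ℂ L} {e : ℕ → L} {u v : L} {i j : ℕ}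

lemma mem (h : G1Frame n N e) (h₁ : 1 ≤ i) (h₂ : i ≤ n) : e i ∈ N :=
  h.span_eq ▸ mem_tailSpan h₁ h₂

lemma tailSpan_le (h : G1Frame n N e) (hi : 1 ≤ i) : tailSpan n e i ≤ N :=
  h.span_eq ▸ tailSpan_anti hi

lemma br_self (h : G1Frame n N e) (hu : u ∈ N) : br u u = 0 := by
  have h₂ : (2 : ℂ) • br u u = 0 := by
    rw [two_smul]
    nth_rewrite 1 [h.anti u hu u hu]
    exact neg_add_cancel _
  simpa using h₂

lemma coeff_eq_zero (h : G1Frame n N e) (h₁ : 1 ≤ i) (h₂ : i ≤ n) {c : ℂ}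
    (hc : c • e i ∈ tailSpan n e (i + 1)) : c = 0 := by
  by_contra h0
  exact h.notMem i h₁ h₂ (by simpa [h0] using (tailSpan n e (i + 1)).smul_mem c⁻¹ hc)

lemma coeff_last (h : G1Frame n N e) (hn : 1 ≤ n) {c : ℂ} (hc : c • e n = 0) : c = 0 :=
  h.coeff_eq_zero hn le_rfl (hc ▸ Submodule.zero_mem _)

lemma one_br_mem (h : G1Frame n N e) (hi : 2 ≤ i) (hu : u ∈ tailSpan n e i) :
    br (e 1) u ∈ tailSpan n e (i + 1) := by
  suffices tailSpan n e i ≤ (tailSpan n e (i + 1)).comap (br (e 1)) from this hu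
  refine LeibnizAlgebra.tailSpan_le fun t h₁ h₂ => ?_
  rw [Submodule.mem_comap]
  rcases Nat.lt_or_ge n (t + 2) with ht | ht
  · obtain rfl | rfl : t = n - 1 ∨ t = n := by omega
    · rw [h.one_br_pred]; exact Submodule.zero_mem _
    · rw [h.one_br_last]; exact Submodule.zero_mem _
  · rw [h.one_br t (hi.trans h₁) ht]
    exact mem_tailSpan (by omega) (by omega)

lemma br_mem_last (h : G1Frame n N e) (hu : u ∈ tailSpan n e 2) (hv : v ∈ tailSpan n e 2) :
    br u v ∈ tailSpan n e n := by
  refine br_mem_of_mem_tailSpan (fun s t hs₁ hs₂ ht₁ ht₂ => ?_) hu hv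
  by_cases hst : s + t = n
  · rw [h.br_add_eq s t hs₁ ht₁ hst]
    exact Submodule.smul_mem _ _ (mem_tailSpan le_rfl le_rfl)
  · rw [h.br_add_ne s t hs₁ hs₂ ht₁ ht₂ hst]
    exact Submodule.zero_mem _

lemma br_eq_zero (h : G1Frame n N e) (hi : 2 ≤ i) (hj : 2 ≤ j) (hij : n < i + j)
    (hu : u ∈ tailSpan n e i) (hv : v ∈ tailSpan n e j) : br u v = 0 := by
  rw [← Submodule.mem_bot ℂ]
  refine br_mem_of_mem_tailSpan (fun s t hs₁ hs₂ ht₁ ht₂ => ?_) hu hv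
  rw [h.br_add_ne s t (by omega) hs₂ (by omega) ht₂ (by omega)]
  exact Submodule.zero_mem _

lemma exists_one (h : G1Frame n N e) (hn : 1 ≤ n) (hu : u ∈ N) :
    ∃ c : ℂ, u - c • e 1 ∈ tailSpan n e 2 :=
  exists_of_mem_tailSpan hn (h.span_eq ▸ hu)

lemma br_central (h : G1Frame n N e) (hn : 7 ≤ n) (hu : u ∈ N) (hv : v ∈ tailSpan n e (n - 1)) :
    br u v = 0 := by
  obtain ⟨c, hc⟩ := h.exists_one (by omega) hu
  have h₁ : br (e 1) v = 0 := by
    obtain ⟨c, d, rfl⟩ := exists_of_mem_tailSpan_pred (by omega) hv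
    simp [h.one_br_pred, h.one_br_last]
  have h₂ := h.br_eq_zero (le_refl 2) (by omega) (by omega) hc hv
  simpa [h₁] using h₂

lemma central_br (h : G1Frame n N e) (hn : 7 ≤ n) (hu : u ∈ N) (hv : v ∈ tailSpan n e (n - 1)) :
    br v u = 0 := by
  rw [h.anti v (h.tailSpan_le (by omega) hv) u hu, h.br_central hn hu hv, neg_zero]

lemma br_mem_three (h : G1Frame n N e) (hn : 7 ≤ n) (hu : u ∈ N) (hv : v ∈ N) :
    br u v ∈ tailSpan n e 3 := by
  obtain ⟨c, hc⟩ := h.exists_one (by omega) hu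
  obtain ⟨d, hd⟩ := h.exists_one (by omega) hv
  have h₁ := h.one_br_mem le_rfl hc
  have h₂ := h.one_br_mem le_rfl hd
  have h₃ := tailSpan_anti (show 3 ≤ n by omega) (h.br_mem_last hc hd)
  have h₄ := h.br_self (h.mem le_rfl (show 1 ≤ n by omega))
  have h₅ : br (u - c • e 1) (e 1) = -br (e 1) (u - c • e 1) :=
    h.anti _ (h.tailSpan_le (by omega) hc) _ (h.mem le_rfl (by omega))
  have key : br u v = c • br (e 1) (v - d • e 1) + d • br (u - c • e 1) (e 1)
      + br (u - c • e 1) (v - d • e 1) := by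
    simp only [map_sub, map_smul, LinearMap.sub_apply, LinearMap.smul_apply, h₄]
    module
  rw [key, h₅]
  exact add_mem (add_mem (Submodule.smul_mem _ _ h₂)
    (Submodule.smul_mem _ _ (neg_mem h₁))) h₃

/-- Commuting with `e_2` kills the coefficient of `e_1`, because `[e_2,e_1] = -e_3` while the other
products with `e_2` are multiples of `e_n`. Commuting with `e_1` then kills the coefficients of
`e_2, …, e_{n-2}` one by one, since it shifts them. -/
lemma mem_center (h : G1Frame n N e) (hn : 7 ≤ n) (hu : u ∈ N) (h₁ : br (e 1) u = 0)
    (h₂ : br (e 2) u = 0) : u ∈ tailSpan n e (n - 1) := by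
  have key : ∀ k, k + 2 ≤ n - 1 → u ∈ tailSpan n e (k + 2) := by
    intro k
    induction k with
    | zero =>
      intro _
      obtain ⟨c, hc⟩ := h.exists_one (by omega) hu
      have h₃ := h.br_mem_last (mem_tailSpan (le_refl 2) (by omega)) hc
      have h₄ : br (e 2) (e 1) = -e 3 := by
        rw [h.anti _ (h.mem (by omega) (by omega)) _ (h.mem (by omega) (by omega)),
          h.one_br 2 le_rfl (by omega)]
      rw [map_sub, map_smul, h₂, h₄, zero_sub, smul_neg, neg_neg] at h₃
      rw [h.coeff_eq_zero (by omega) (by omega) (tailSpan_anti (by omega) h₃)] at hc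
      simpa using hc
    | succ k ih =>
      intro hk
      obtain ⟨c, hc⟩ := exists_of_mem_tailSpan (show k + 2 ≤ n by omega) (ih (by omega))
      have h₃ := h.one_br_mem (by omega) hc
      rw [map_sub, map_smul, h₁, h.one_br _ (by omega) (by omega), zero_sub, neg_mem_iff] at h₃
      rw [h.coeff_eq_zero (by omega) (by omega) h₃] at hc
      simpa using hc
  have := key (n - 3) (by omega)
  rwa [show n - 3 + 2 = n - 1 by omega] at this

lemma congr (h : G1Frame n N e) (hn : 7 ≤ n) {e' : ℕ → L} (he : ∀ i, 1 ≤ i → i ≤ n → e' i = e i) :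
    G1Frame n N e' where
  one_br i h₁ h₂ := by
    rw [he 1 le_rfl (by omega), he i (by omega) (by omega), he _ (by omega) (by omega),
      h.one_br i h₁ h₂]
  one_br_pred := by
    rw [he 1 le_rfl (by omega), he _ (by omega) (by omega), h.one_br_pred]
  one_br_last := by
    rw [he 1 le_rfl (by omega), he _ (by omega) (by omega), h.one_br_last]
  br_add_eq i j h₁ h₂ h₃ := by
    rw [he i (by omega) (by omega), he j (by omega) (by omega), he n (by omega) (by omega),
      h.br_add_eq i j h₁ h₂ h₃]
  br_add_ne i j h₁ h₂ h₃ h₄ h₅ := by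
    rw [he i (by omega) (by omega), he j (by omega) (by omega), h.br_add_ne i j h₁ h₂ h₃ h₄ h₅]
  anti := h.anti
  span_eq := by rw [tailSpan_congr fun t h₁ h₂ => he t h₁ h₂, h.span_eq]
  notMem i h₁ h₂ := by
    rw [he i h₁ h₂, tailSpan_congr fun t h₁ h₂ => he t (by omega) h₂]
    exact h.notMem i h₁ h₂

lemma hasG1Table (h : G1Frame n N e) (hodd : Odd n) (hn : 7 ≤ n) : HasG1Table n e := by
  intro i j hi₁ hi₂ hj₁ hj₂
  have hsign : ∀ i j : ℕ, i + j = n → (-1 : ℂ) ^ i = -(-1) ^ j := by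
    intro i j hij
    have h1 : (-1 : ℂ) ^ i * (-1) ^ j = -1 := by rw [← pow_add, hij, hodd.neg_one_pow]
    have h2 : (-1 : ℂ) ^ j * (-1) ^ j = 1 := by rw [← mul_pow]; norm_num
    linear_combination (-1 : ℂ) ^ j * h1 - (-1 : ℂ) ^ i * h2
  have he1 := h.mem le_rfl (show 1 ≤ n by omega)
  unfold g1Product
  split_ifs with c₁ c₂ c₃ c₄
  · obtain ⟨rfl, c₁⟩ := c₁
    exact h.one_br j c₁.1 c₁.2
  · obtain ⟨rfl, c₂⟩ := c₂
    rw [h.anti _ (h.mem hi₁ hi₂) _ he1, h.one_br i c₂.1 c₂.2]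
  · exact h.br_add_eq i j c₃.2.1 (by omega) c₃.1
  · rw [h.br_add_eq i j (by omega) (by omega) c₄.1, hsign i j c₄.1, neg_smul]
  · have hone : ∀ j, 1 ≤ j → j ≤ n → ¬(2 ≤ j ∧ j + 2 ≤ n) → br (e 1) (e j) = 0 := by
      intro j h₁ h₂ h₃
      obtain rfl | rfl | rfl : j = 1 ∨ j = n - 1 ∨ j = n := by omega
      exacts [h.br_self he1, h.one_br_pred, h.one_br_last]
    by_cases hi : i = 1
    · subst hi
      exact hone j hj₁ hj₂ (by omega)
    by_cases hj : j = 1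
    · subst hj
      rw [h.anti _ (h.mem hi₁ hi₂) _ he1, hone i hi₁ hi₂ (by omega), neg_zero]
    · obtain ⟨m, rfl⟩ := hodd
      exact h.br_add_ne i j (by omega) hi₂ (by omega) hj₂ (by omega)

end G1Frame

end Frame

lemma g1Product_antisymm {V : Type*} [AddCommGroup V] [Module ℂ V] {n : ℕ} (hodd : Odd n)
    (e : ℕ → V) (i j : ℕ) :
    g1Product n e i j = -g1Product n e j i := by
  obtain ⟨m, rfl⟩ := hodd
  unfold g1Product
  split_ifs <;> first | omega | simp

/-! ### From the table to a frame, and changes of frame. -/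

section Frame

variable {L : Type*} [AddCommGroup L] [Module ℂ L] [LeibnizAlgebra L]
  {n : ℕ} {N : Submodule ℂ L} {e : ℕ → L}

/-- The table lists `[e_i, e_{n-i}]` only for `i ≤ (n-1)/2`. As `n` is odd, `i` and `n-i` have
opposite parity, so antisymmetry extends the same formula `(-1)^i e_n` to all `2 ≤ i ≤ n-2`. -/
lemma IsG1.exists_frame (hodd : Odd n) (hn : 7 ≤ n) (hG : IsG1 n N) :
    ∃ e : ℕ → L, G1Frame n N e := by
  obtain ⟨b, hb⟩ := hG
  set e : ℕ → L := fun i => ((vec b i : N) : L) with he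
  have hvec : ∀ k : Fin n, e (k + 1) = (b k : L) := by
    intro k
    have : 1 ≤ (k : ℕ) + 1 ∧ (k : ℕ) + 1 ≤ n := ⟨by omega, k.2⟩
    simp [he, vec, Nat.succ_le_iff]
  have himage : ∀ i, e '' Set.Icc (i + 1) n =
      (fun k : Fin n => (b k : L)) '' {k | i ≤ (k : ℕ)} := by
    intro i
    ext u
    constructor
    · rintro ⟨t, ht, rfl⟩
      rw [Set.mem_Icc] at ht
      refine ⟨⟨t - 1, by omega⟩, by simp; omega, ?_⟩
      simp only [← hvec]
      congr 1
      omega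
    · rintro ⟨k, hk, rfl⟩
      exact ⟨k + 1, ⟨by simpa using hk, k.2⟩, hvec k⟩
  have hspan : tailSpan n e 1 = N := by
    rw [tailSpan, show (1 : ℕ) = 0 + 1 from rfl, himage 0]
    have : (fun k : Fin n => (b k : L)) '' {k | 0 ≤ (k : ℕ)} = N.subtype '' Set.range b := by
      rw [← Set.range_comp]
      simp [Set.image_univ, Function.comp_def]
    rw [this, Submodule.span_image, b.span_eq, Submodule.map_top, Submodule.range_subtype]
  have hli : LinearIndependent ℂ (fun k : Fin n => (b k : L)) :=
    b.linearIndependent.map' N.subtype N.ker_subtype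
  refine ⟨e, ⟨?_, ?_, ?_, ?_, ?_, ?_, hspan, ?_⟩⟩
  · intro i h₁ h₂
    rw [hb 1 i le_rfl (by omega) (by omega) (by omega), g1Product, if_pos ⟨rfl, h₁, h₂⟩]
  · rw [hb 1 (n - 1) le_rfl (by omega) (by omega) (by omega), g1Product]
    repeat rw [if_neg (by omega)]
  · rw [hb 1 n le_rfl (by omega) (by omega) (by omega), g1Product]
    repeat rw [if_neg (by omega)]
  · intro i j h₁ h₂ h₃
    rw [hb i j (by omega) (by omega) (by omega) (by omega), g1Product, if_neg (by omega),
      if_neg (by omega)]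
    by_cases hi : 2 * i + 1 ≤ n
    · rw [if_pos ⟨h₃, h₁, hi⟩]
    · obtain ⟨m, hm⟩ := hodd
      rw [if_neg (by omega), if_pos ⟨h₃, h₂, by omega⟩, ← neg_smul]
      congr 1
      have h1 : (-1 : ℂ) ^ i * (-1) ^ j = -1 := by
        rw [← pow_add, h₃, hm]; exact (odd_two_mul_add_one m).neg_one_pow
      have h2 : (-1 : ℂ) ^ j * (-1) ^ j = 1 := by rw [← mul_pow]; norm_num
      linear_combination (-(-1 : ℂ) ^ j) * h1 + (-1 : ℂ) ^ i * h2
  · intro i j h₁ h₂ h₃ h₄ h₅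
    rw [hb i j (by omega) (by omega) (by omega) (by omega), g1Product]
    repeat rw [if_neg (by omega)]
  · intro a ha c hc
    rw [← hspan] at ha hc
    have h' : Submodule.map₂ (br + br.flip) (tailSpan n e 1) (tailSpan n e 1) ≤ ⊥ := by
      rw [tailSpan, Submodule.map₂_span_span, Submodule.span_le]
      rintro _ ⟨_, ⟨s, hs, rfl⟩, _, ⟨t, ht, rfl⟩, rfl⟩
      rw [Set.mem_Icc] at hs ht
      simp only [LinearMap.add_apply, LinearMap.flip_apply, SetLike.mem_coe, Submodule.mem_bot]
      rw [hb s t hs.1 hs.2 ht.1 ht.2, hb t s ht.1 ht.2 hs.1 hs.2, g1Product_antisymm hodd,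
        neg_add_cancel]
    exact eq_neg_of_add_eq_zero_left ((Submodule.mem_bot ℂ).1 (Submodule.map₂_le.1 h' a ha c hc))
  · intro i h₁ h₂
    obtain ⟨k, rfl⟩ : ∃ k, i = k + 1 := ⟨i - 1, by omega⟩
    rw [hvec ⟨k, by omega⟩, tailSpan, himage (k + 1)]
    exact hli.notMem_span_image (by simp)

namespace G1Frame

/-- A unitriangular change of basis need only be checked on products of index sum below `n`. Sums
above `n` vanish by the filtration; for sum `n`, leading terms settle `[e'_2, e'_{n-2}]`, and
Leibniz moves along the antidiagonal. -/
lemma of_triangular (h : G1Frame n N e) (hn : 7 ≤ n) {e' : ℕ → L}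
    (h₁ : e' 1 - e 1 ∈ tailSpan n e 2) (h₂ : e' 2 - e 2 ∈ tailSpan n e 3)
    (hrec : ∀ i, 2 ≤ i → i + 2 ≤ n → br (e' 1) (e' i) = e' (i + 1)) (hlast : e' n = e n)
    (hzero : ∀ i j, 2 ≤ i → 2 ≤ j → i + j < n → br (e' i) (e' j) = 0) :
    G1Frame n N e' ∧ ∀ i, 1 ≤ i → tailSpan n e' i = tailSpan n e i := by
  have tri : ∀ i, 2 ≤ i → i + 1 ≤ n → e' i - e i ∈ tailSpan n e (i + 1) := by
    intro i hi
    induction i, hi using Nat.le_induction with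
    | base => exact fun _ => h₂
    | succ i hi ih =>
      intro hin
      have hi' : e' i ∈ tailSpan n e 2 := by
        have := add_mem (tailSpan_anti (show 2 ≤ i + 1 by omega) (ih (by omega)))
          (mem_tailSpan (e := e) (show 2 ≤ i by omega) (show i ≤ n by omega))
        simpa using this
      have key : e' (i + 1) - e (i + 1) = br (e' 1 - e 1) (e' i) + br (e 1) (e' i - e i) := by
        rw [← hrec i hi (by omega), ← h.one_br i hi (by omega)]
        simp
      rw [key]
      exact add_mem (tailSpan_anti (by omega) (h.br_mem_last h₁ hi'))
        (h.one_br_mem (by omega) (ih (by omega)))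
  have tri' : ∀ i, 1 ≤ i → i ≤ n → e' i - e i ∈ tailSpan n e (i + 1) := by
    intro i hi hin
    rcases (show i = 1 ∨ i = n ∨ (2 ≤ i ∧ i + 1 ≤ n) by omega) with rfl | rfl | h3
    · exact h₁
    · simp [hlast]
    · exact tri i h3.1 h3.2
  have mem' : ∀ i, 1 ≤ i → i ≤ n → e' i ∈ tailSpan n e i := by
    intro i hi hin
    have := add_mem (tailSpan_anti (Nat.le_succ i) (tri' i hi hin)) (mem_tailSpan le_rfl hin)
    simpa using this
  have le' : ∀ i, 1 ≤ i → tailSpan n e' i ≤ tailSpan n e i := fun i hi =>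
    LeibnizAlgebra.tailSpan_le fun t ht₁ ht₂ => tailSpan_anti ht₁ (mem' t (by omega) ht₂)
  have ge' : ∀ k i, 1 ≤ i → n + 1 ≤ i + k → tailSpan n e i ≤ tailSpan n e' i := by
    intro k
    induction k with
    | zero => intro i _ hi; rw [tailSpan_eq_bot (by omega)]; exact bot_le
    | succ k ih =>
      intro i hi hik
      refine LeibnizAlgebra.tailSpan_le fun t ht₁ ht₂ => ?_
      have h3 := tailSpan_anti (show i ≤ t + 1 by omega)
        (ih (t + 1) (by omega) (by omega) (tri' t (by omega) ht₂))
      simpa using sub_mem (mem_tailSpan (e := e') ht₁ ht₂) h3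
  have anti : ∀ i j, 2 ≤ i → i ≤ n → 2 ≤ j → j ≤ n → br (e' i) (e' j) = -br (e' j) (e' i) :=
    fun i j hi hi' hj hj' =>
      h.anti _ (h.tailSpan_le (by omega) (mem' i (by omega) hi')) _
        (h.tailSpan_le (by omega) (mem' j (by omega) hj'))
  have mem₁ := h.tailSpan_le le_rfl (mem' 1 le_rfl (by omega))
  refine ⟨⟨hrec, h.br_central hn mem₁ (mem' _ (by omega) (by omega)),
    h.br_central hn mem₁ (hlast ▸ mem_tailSpan (by omega) le_rfl), ?_, ?_, h.anti,
    le_antisymm ((le' 1 le_rfl).trans h.span_eq.le)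
      (h.span_eq.ge.trans (ge' n 1 le_rfl (by omega))), ?_⟩,
    fun i hi => le_antisymm (le' i hi) (ge' n i hi (by omega))⟩
  · intro i j hi
    induction i, hi using Nat.le_induction generalizing j with
    | base =>
      intro hj hij
      have h3 : br (e' 2 - e 2) (e' j) = 0 :=
        h.br_eq_zero (by omega) hj (by omega) h₂ (mem' j (by omega) (by omega))
      have h4 : br (e 2) (e' j - e j) = 0 :=
        h.br_eq_zero le_rfl (by omega) (by omega) (mem_tailSpan le_rfl (by omega))
          (tri j hj (by omega))
      rw [map_sub, LinearMap.sub_apply, sub_eq_zero] at h3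
      rw [map_sub, sub_eq_zero] at h4
      rw [h3, h4, h.br_add_eq 2 j le_rfl hj hij, hlast]
    | succ i hi ih =>
      intro hj hij
      -- Here `i + j = n - 1`, so `[e'_i, e'_j] = 0`; bracketing with `e'_1` gives `[e'_{i+1}, e'_j]
      -- = [e'_{j+1}, e'_i]`, whence the alternating sign.
      have h3 := leibniz (e' 1) (e' i) (e' j)
      rw [hzero i j hi hj (by omega), map_zero, hrec i hi (by omega), hrec j hj (by omega),
        eq_comm, sub_eq_zero] at h3
      rw [h3, anti _ _ (by omega) (by omega) (by omega) (by omega),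
        ih (j + 1) (by omega) (by omega), pow_succ]
      simp
  · intro i j hi hi' hj hj' hij
    rcases Nat.lt_or_ge (i + j) n with hlt | hge
    · exact hzero i j hi hj hlt
    · exact h.br_eq_zero hi hj (by omega) (mem' i (by omega) hi') (mem' j (by omega) hj')
  · intro i hi hi' hmem
    refine h.notMem i hi hi' ?_
    simpa using sub_mem (le' (i + 1) (by omega) hmem) (tri' i hi hi')

/-- The change of basis by `e_1 ↦ e_1 + s e_2 + p e_n`, `e_2 ↦ e_2 + q e_n`. -/
lemma shear (h : G1Frame n N e) (hn : 7 ≤ n) (s p q : ℂ) :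
    ∃ e' : ℕ → L, G1Frame n N e' ∧ e' 1 = e 1 + s • e 2 + p • e n ∧ e' 2 = e 2 + q • e n ∧
      e' (n - 1) = e (n - 1) + s • e n ∧
      ∀ i, 3 ≤ i → i ≠ n - 1 → e' i = e i := by
  -- The change at `n - 1` is forced: `[e_1 + s e_2, e_{n-2}] = e_{n-1} + s e_n`.
  set e' : ℕ → L := fun i => if i = 1 then e 1 + s • e 2 + p • e n else
    if i = 2 then e 2 + q • e n else if i = n - 1 then e (n - 1) + s • e n else e i with he'
  have e₁ : e' 1 = e 1 + s • e 2 + p • e n := by simp [he']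
  have e₂ : e' 2 = e 2 + q • e n := by simp [he']
  have e₃ : e' (n - 1) = e (n - 1) + s • e n := by
    change (if n - 1 = 1 then _ else if n - 1 = 2 then _ else if n - 1 = n - 1 then _ else _) = _
    rw [if_neg (by omega), if_neg (by omega), if_pos rfl]
  have e₄ : ∀ i, 3 ≤ i → i ≠ n - 1 → e' i = e i := by
    intro i h₁ h₂
    simp only [he']
    rw [if_neg (by omega), if_neg (by omega), if_neg h₂]
  have hcl : ∀ u ∈ N, br u (e n) = 0 := fun u hu =>
    h.br_central hn hu (mem_tailSpan (by omega) le_rfl)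
  have hcr : ∀ u ∈ N, br (e n) u = 0 := fun u hu =>
    h.central_br hn hu (mem_tailSpan (by omega) le_rfl)
  have hmem : ∀ i, 1 ≤ i → i ≤ n → e i ∈ N := fun i h₁ h₂ => h.mem h₁ h₂
  refine ⟨e', (h.of_triangular hn ?_ ?_ ?_ ?_ ?_).1, e₁, e₂, e₃, e₄⟩
  · rw [e₁, add_assoc, add_sub_cancel_left]
    exact add_mem (Submodule.smul_mem _ _ (mem_tailSpan le_rfl (by omega)))
      (Submodule.smul_mem _ _ (mem_tailSpan (by omega) le_rfl))
  · rw [e₂, add_sub_cancel_left]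
    exact Submodule.smul_mem _ _ (mem_tailSpan (by omega) le_rfl)
  · intro i h₁ h₂
    rw [e₁]
    rcases (show i = 2 ∨ (3 ≤ i ∧ i + 2 < n) ∨ i + 2 = n by omega) with rfl | hi | hi
    · rw [e₂, e₄ _ (by omega) (by omega)]
      simp [h.one_br 2 le_rfl h₂, h.one_br_last,
        h.br_add_ne 2 2 le_rfl (by omega) le_rfl (by omega) (by omega),
        hcl (e 2) (hmem 2 (by omega) (by omega)),
        hcr (e 2) (hmem 2 (by omega) (by omega)), hcl (e n) (hmem n (by omega) (by omega))]
    · rw [e₄ i hi.1 (by omega), e₄ (i + 1) (by omega) (by omega)]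
      simp [h.one_br i h₁ h₂, h.br_add_ne 2 i le_rfl (by omega) h₁ (by omega) (by omega),
        hcr (e i) (hmem i (by omega) (by omega))]
    · rw [e₄ i (by omega) (by omega), show i + 1 = n - 1 by omega, e₃]
      simp [h.one_br i h₁ h₂, h.br_add_eq 2 i le_rfl h₁ (by omega),
        hcr (e i) (hmem i (by omega) (by omega)), show i + 1 = n - 1 by omega]
  · exact e₄ n (by omega) (by omega)
  · intro i j hi hj hij
    have hform : ∀ i, 2 ≤ i → i + 2 < n → ∃ c : ℂ, e' i = e i + c • e n := by
      intro i h₁ h₂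
      rcases (show i = 2 ∨ 3 ≤ i by omega) with rfl | h3
      · exact ⟨q, e₂⟩
      · exact ⟨0, by rw [e₄ i h3 (by omega)]; simp⟩
    obtain ⟨c, hc⟩ := hform i hi (by omega)
    obtain ⟨d, hd⟩ := hform j hj (by omega)
    rw [hc, hd]
    simp [hcl (e i) (hmem i (by omega) (by omega)), hcr (e j) (hmem j (by omega) (by omega)),
      hcl (e n) (hmem n (by omega) (by omega)),
      h.br_add_ne i j hi (by omega) hj (by omega) (by omega)]

end G1Frame

/-! ### Derivations of `N` and their weights. -/

/-- `D` restricts to a derivation of `N`. -/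
structure IsDerivationOn (N : Submodule ℂ L) (D : L →ₗ[ℂ] L) : Prop where
  map_mem : ∀ u ∈ N, D u ∈ N
  map_br : ∀ u ∈ N, ∀ v ∈ N, D (br u v) = br (D u) v + br u (D v)

lemma isDerivationOn_right {N : Submodule ℂ L} (hN : IsIdeal N) (x : L) :
    IsDerivationOn N (br.flip x) where
  map_mem u hu := (hN u hu x).1
  map_br u _ v _ := by
    simp only [LinearMap.flip_apply]
    rw [leibniz u v x]
    abel

namespace G1Frame

variable {D : L →ₗ[ℂ] L}

/-- Apply `D` to `[e_2, e_3] = 0`, a relation that fails for `n = 5`. If `D e_2` had an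
`e_1`-coefficient `c`, the result would contain `c e_4`, while all other terms are multiples of
`e_n`. -/
lemma derivation_two (h : G1Frame n N e) (hn : 7 ≤ n) (hD : IsDerivationOn N D) :
    ∃ b : ℂ, D (e 2) - b • e 2 ∈ tailSpan n e 3 := by
  have hmem : ∀ i, 1 ≤ i → i ≤ n → e i ∈ N := fun i h₁ h₂ => h.mem h₁ h₂
  obtain ⟨c, hc⟩ := h.exists_one (by omega) (hD.map_mem _ (hmem 2 (by omega) (by omega)))
  have h₃ : D (e 3) ∈ tailSpan n e 2 := by
    rw [← h.one_br 2 le_rfl (by omega), hD.map_br _ (hmem 1 (by omega) (by omega)) _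
      (hmem 2 (by omega) (by omega))]
    refine tailSpan_anti (show 2 ≤ 3 by omega) (add_mem (h.br_mem_three hn ?_ ?_)
      (h.br_mem_three hn ?_ ?_)) <;>
    first | exact hmem _ (by omega) (by omega) | exact hD.map_mem _ (hmem _ (by omega) (by omega))
  have h₄ := hD.map_br _ (hmem 2 (by omega) (by omega)) _ (hmem 3 (by omega) (by omega))
  rw [h.br_add_ne 2 3 le_rfl (by omega) (by omega) (by omega) (by omega), map_zero] at h₄
  have h₅ := h.br_mem_last hc (mem_tailSpan (show 2 ≤ 3 by omega) (by omega))
  have h₆ := h.br_mem_last (mem_tailSpan (le_refl 2) (by omega)) h₃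
  rw [map_sub, map_smul, LinearMap.sub_apply, LinearMap.smul_apply,
    h.one_br 3 (by omega) (by omega)] at h₅
  have h₇ : c • e 4 ∈ tailSpan n e 5 := by
    have h8 := neg_mem (add_mem h₅ h₆)
    refine tailSpan_anti (show 5 ≤ n by omega) ?_
    convert h8 using 1
    rw [eq_comm, neg_eq_iff_add_eq_zero, h₄]
    simp only [Nat.reduceAdd]
    abel
  rw [h.coeff_eq_zero (by omega) (by omega) h₇, zero_smul, sub_zero] at hc
  exact exists_of_mem_tailSpan (by omega) hc

variable {a b : ℂ}

/-- Each bracket with `e_1` adds `a` to the weight; the error `[D e_1 - a e_1, e_i]` is a multiple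
of `e_n`. -/
lemma derivation_apply (h : G1Frame n N e) (hn : 7 ≤ n) (hD : IsDerivationOn N D)
    (h₁ : D (e 1) - a • e 1 ∈ tailSpan n e 2) (h₂ : D (e 2) - b • e 2 ∈ tailSpan n e 3)
    {i : ℕ} (hi : 2 ≤ i) (hin : i + 1 ≤ n) :
    D (e i) - (((i : ℂ) - 2) * a + b) • e i ∈ tailSpan n e (i + 1) := by
  induction i, hi using Nat.le_induction with
  | base => simpa using h₂
  | succ i hi ih =>
    have h₃ := h.one_br_mem (by omega) (ih (by omega))
    have h₄ := tailSpan_anti (show i + 1 + 1 ≤ n by omega)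
      (h.br_mem_last h₁ (mem_tailSpan hi (show i ≤ n by omega)))
    convert add_mem h₃ h₄ using 1
    rw [← h.one_br i hi (by omega), hD.map_br _ (h.mem (by omega) (by omega)) _
      (h.mem (by omega) (by omega))]
    simp only [map_sub, map_smul, LinearMap.sub_apply, LinearMap.smul_apply]
    push_cast
    module

/-- Weights add in `e_n = [e_2, e_{n-2}]`. The triangular errors drop out because their index sums
exceed `n`, so the equality is exact. -/
lemma derivation_last (h : G1Frame n N e) (hn : 7 ≤ n) (hD : IsDerivationOn N D)
    (h₁ : D (e 1) - a • e 1 ∈ tailSpan n e 2) (h₂ : D (e 2) - b • e 2 ∈ tailSpan n e 3) :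
    D (e n) = (((n : ℂ) - 4) * a + 2 * b) • e n := by
  have h₃ := h.derivation_apply hn hD h₁ h₂ (show 2 ≤ n - 2 by omega) (by omega)
  have h₄ : br (e 2) (e (n - 2)) = e n := by
    rw [h.br_add_eq 2 (n - 2) le_rfl (by omega) (by omega)]; simp
  have h₅ := h.br_eq_zero (by omega) (by omega) (by omega) h₂
    (mem_tailSpan (le_refl (n - 2)) (by omega))
  have h₆ := h.br_eq_zero (by omega) (by omega) (by omega)
    (mem_tailSpan (le_refl 2) (by omega)) h₃
  simp only [map_sub, map_smul, LinearMap.sub_apply, LinearMap.smul_apply, h₄,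
    sub_eq_zero] at h₅ h₆
  rw [← h₄, hD.map_br _ (h.mem (by omega) (by omega)) _ (h.mem (by omega) (by omega)), h₅, h₆,
    h₄, ← add_smul]
  congr 1
  rw [Nat.cast_sub (by omega)]
  push_cast
  ring

end G1Frame

end Frame

/-! ### Extensions by one element, nilpotency and eigenvectors. -/

section Extension

variable {L : Type*} [AddCommGroup L] [Module ℂ L] [LeibnizAlgebra L]
  {n : ℕ} {N : Submodule ℂ L} {e : ℕ → L} {x : L}

/-- `N` is an ideal and `x` spans a complement of it. -/
structure IsOneExtension (N : Submodule ℂ L) (x : L) : Prop where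
  ideal : IsIdeal N
  notMem : x ∉ N
  exists_add : ∀ u : L, ∃ v ∈ N, ∃ c : ℂ, u = v + c • x

namespace IsOneExtension

lemma add (h : IsOneExtension N x) {v : L} (hv : v ∈ N) : IsOneExtension N (x + v) where
  ideal := h.ideal
  notMem hx := h.notMem (by simpa using sub_mem hx hv)
  exists_add u := by
    obtain ⟨w, hw, c, rfl⟩ := h.exists_add u
    exact ⟨w - c • v, sub_mem hw (N.smul_mem c hv), c, by module⟩

lemma smul (h : IsOneExtension N x) {a : ℂ} (ha : a ≠ 0) : IsOneExtension N (a • x) where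
  ideal := h.ideal
  notMem hx := h.notMem (by simpa [ha] using N.smul_mem a⁻¹ hx)
  exists_add u := by
    obtain ⟨w, hw, c, rfl⟩ := h.exists_add u
    exact ⟨w, hw, c * a⁻¹, by rw [smul_smul, inv_mul_cancel_right₀ ha]⟩

lemma derivation (h : IsOneExtension N x) : IsDerivationOn N (br.flip x) :=
  isDerivationOn_right h.ideal x

lemma br_br_self (u : L) : br u (br x x) = 0 := by
  rw [leibniz, sub_self]

/-- If `[x,x] = v + c x` with `v ∈ N`, then `[x,[x,x]] = 0` gives `c² x ∈ N`, so `c = 0`. -/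
lemma self_br_mem (h : IsOneExtension N x) : br x x ∈ N := by
  obtain ⟨v, hv, c, hc⟩ := h.exists_add (br x x)
  have h₁ : br x (br x x) = 0 := br_br_self x
  rw [hc, map_add, map_smul, hc] at h₁
  have h₂ : (c * c) • x ∈ N := by
    have h3 : (c * c) • x = -(br x v) - c • v := by
      rw [eq_sub_iff_add_eq, eq_neg_iff_add_eq_zero, ← h₁]
      module
    rw [h3]
    exact sub_mem (neg_mem (h.ideal v hv x).2) (N.smul_mem c hv)
  have h₃ : c = 0 := by
    by_contra h0
    exact h.notMem ((N.smul_mem_iff (mul_ne_zero h0 h0)).1 h₂)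
  rw [hc, h₃, zero_smul, add_zero]
  exact hv

end IsOneExtension

namespace G1Frame

lemma br_mem_succ (h : G1Frame n N e) (hn : 7 ≤ n) {i : ℕ} (hi : 1 ≤ i) {u v : L}
    (hu : u ∈ tailSpan n e i) (hv : v ∈ N) : br u v ∈ tailSpan n e (i + 1) := by
  rcases (show i = 1 ∨ n - 1 ≤ i ∨ (2 ≤ i ∧ i + 1 ≤ n) by omega) with rfl | h₁ | ⟨h₁, h₂⟩
  · exact tailSpan_anti (show 2 ≤ 3 by omega) (h.br_mem_three hn (h.tailSpan_le hi hu) hv)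
  · rw [h.central_br hn hv (tailSpan_anti h₁ hu)]
    exact Submodule.zero_mem _
  · obtain ⟨c, hc⟩ := h.exists_one (by omega) hv
    have h₃ := h.br_mem_last (tailSpan_anti h₁ hu) hc
    have h₄ := h.one_br_mem h₁ hu
    have h₅ := h.anti u (h.tailSpan_le hi hu) (e 1) (h.mem le_rfl (by omega))
    have h₆ : br u v = br u (v - c • e 1) - c • br (e 1) u := by
      rw [map_sub, map_smul, h₅]
      module
    rw [h₆]
    exact sub_mem (tailSpan_anti h₂ h₃) (Submodule.smul_mem _ _ h₄)

/-- With both weights zero, right multiplication by `x`, like that by `N`, moves each tail span into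
the next. As the lower central series is left-normed and `[R,R] ⊆ N`, it runs down the filtration.
-/
lemma isNilpotentIdeal_top (h : G1Frame n N e) (hn : 7 ≤ n) (hx : IsOneExtension N x)
    (h₁ : br (e 1) x ∈ tailSpan n e 2) (h₂ : br (e 2) x ∈ tailSpan n e 3) :
    IsNilpotentIdeal (⊤ : Submodule ℂ L) := by
  have hD : ∀ i, 1 ≤ i → ∀ u ∈ tailSpan n e i, br u x ∈ tailSpan n e (i + 1) := by
    intro i hi u hu
    suffices tailSpan n e i ≤ (tailSpan n e (i + 1)).comap (br.flip x) from this hu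
    refine LeibnizAlgebra.tailSpan_le fun t ht₁ ht₂ => ?_
    rw [Submodule.mem_comap]
    have h₁' : br.flip x (e 1) - (0 : ℂ) • e 1 ∈ tailSpan n e 2 := by simpa using h₁
    have h₂' : br.flip x (e 2) - (0 : ℂ) • e 2 ∈ tailSpan n e 3 := by simpa using h₂
    rcases (show t = 1 ∨ t = n ∨ (2 ≤ t ∧ t + 1 ≤ n) by omega) with rfl | rfl | ⟨h3, h4⟩
    · exact tailSpan_anti (by omega) h₁
    · simp [h.derivation_last hn hx.derivation h₁' h₂']
    · have h5 := h.derivation_apply hn hx.derivation h₁' h₂' h3 h4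
      simp only [mul_zero, add_zero, zero_smul, sub_zero] at h5
      exact tailSpan_anti (by omega) h5
  have hlc : ∀ k, lowerCentral (⊤ : Submodule ℂ L) (k + 1) ≤ tailSpan n e (k + 1) := by
    intro k
    induction k with
    | zero =>
      refine Submodule.map₂_le.2 fun u _ v _ => ?_
      rw [h.span_eq]
      obtain ⟨u, hu, c, rfl⟩ := hx.exists_add u
      obtain ⟨v, hv, d, rfl⟩ := hx.exists_add v
      simp only [map_add, map_smul, LinearMap.add_apply, LinearMap.smul_apply]
      exact add_mem (add_mem (hx.ideal u hu v).1 (N.smul_mem c (hx.ideal v hv x).2))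
        (N.smul_mem d (add_mem (hx.ideal u hu x).1 (N.smul_mem c hx.self_br_mem)))
    | succ k ih =>
      refine Submodule.map₂_le.2 fun u hu v _ => ?_
      obtain ⟨v, hv, d, rfl⟩ := hx.exists_add v
      rw [map_add, map_smul]
      exact add_mem (h.br_mem_succ hn (by omega) (ih hu) hv)
        (Submodule.smul_mem _ _ (hD _ (by omega) u (ih hu)))
  exact ⟨n + 1, eq_bot_iff.2 ((hlc n).trans (tailSpan_eq_bot (Nat.lt_succ_self n)).le)⟩

/-- The weights of `e_{k+3}` and `e_2` differ by `k+1 ≠ 0`, so the error can be pushed down step by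
step. This stops at `e_n`, whose weight `n-4+2b` may equal `b`. -/
lemma exists_eigenvector (h : G1Frame n N e) (hn : 7 ≤ n) {D : L →ₗ[ℂ] L} {b : ℂ}
    (hD : IsDerivationOn N D)
    (h₁ : D (e 1) - (1 : ℂ) • e 1 ∈ tailSpan n e 2) (h₂ : D (e 2) - b • e 2 ∈ tailSpan n e 3) :
    ∃ w, w - e 2 ∈ tailSpan n e 3 ∧ D w - b • w ∈ tailSpan n e n := by
  have key : ∀ k, k + 3 ≤ n →
      ∃ w, w - e 2 ∈ tailSpan n e 3 ∧ D w - b • w ∈ tailSpan n e (k + 3) := by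
    intro k
    induction k with
    | zero => exact fun _ => ⟨e 2, by simp, h₂⟩
    | succ k ih =>
      intro hk
      obtain ⟨w, hw, hw'⟩ := ih (by omega)
      obtain ⟨c, hc⟩ := exists_of_mem_tailSpan (by omega) hw'
      have h₃ := h.derivation_apply hn hD h₁ h₂ (show 2 ≤ k + 3 by omega) (by omega)
      have hk0 : (k : ℂ) + 1 ≠ 0 := by exact_mod_cast Nat.succ_ne_zero k
      refine ⟨w - (c / (k + 1)) • e (k + 3), ?_, ?_⟩
      · rw [sub_right_comm]
        exact sub_mem hw (Submodule.smul_mem _ _ (mem_tailSpan (by omega) (by omega)))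
      · convert sub_mem hc (Submodule.smul_mem _ (c / (k + 1)) h₃) using 1
        have h₄ : c = c / (k + 1) * ((k : ℂ) + 1) := by field_simp
        rw [map_sub, map_smul]
        nth_rewrite 3 [h₄]
        push_cast
        module
  obtain ⟨w, hw⟩ := key (n - 3) (by omega)
  exact ⟨w, by rwa [show n - 3 + 3 = n by omega] at hw⟩

/-- A basis whose second vector is an eigenvector of the derivation modulo `e_n`. -/
lemma exists_eigenframe (h : G1Frame n N e) (hn : 7 ≤ n) {D : L →ₗ[ℂ] L} {b : ℂ}
    (hD : IsDerivationOn N D)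
    (h₁ : D (e 1) - (1 : ℂ) • e 1 ∈ tailSpan n e 2) (h₂ : D (e 2) - b • e 2 ∈ tailSpan n e 3) :
    ∃ e', G1Frame n N e' ∧ D (e' 1) - (1 : ℂ) • e' 1 ∈ tailSpan n e' 2 ∧
      D (e' 2) - b • e' 2 ∈ tailSpan n e' n := by
  obtain ⟨w, hw, hw'⟩ := h.exists_eigenvector hn hD h₁ h₂
  set e' : ℕ → L := fun i => if i = n then e n else if i = 1 then e 1 else (br (e 1))^[i - 2] w
    with he'
  have e₁ : e' 1 = e 1 := by
    simp only [he']; rw [if_neg (by omega), if_pos trivial]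
  have e₂ : e' 2 = w := by
    simp only [he']; rw [if_neg (by omega), if_neg (by omega)]; rfl
  have e₃ : e' n = e n := by simp [he']
  have e₄ : ∀ i, 2 ≤ i → i + 2 ≤ n → br (e' 1) (e' i) = e' (i + 1) := by
    intro i hi hin
    rw [e₁]
    simp only [he']
    rw [if_neg (by omega), if_neg (by omega), if_neg (by omega), if_neg (by omega),
      show i + 1 - 2 = (i - 2) + 1 by omega, Function.iterate_succ_apply']
  have hmem : ∀ i, 2 ≤ i → i + 1 ≤ n → e' i ∈ tailSpan n e i := by
    intro i hi
    induction i, hi using Nat.le_induction with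
    | base =>
      intro _
      rw [e₂]
      simpa using add_mem (tailSpan_anti (show 2 ≤ 3 by omega) hw)
        (mem_tailSpan (e := e) (le_refl 2) (show 2 ≤ n by omega))
    | succ i hi ih =>
      intro hin
      rw [← e₄ i hi (by omega), e₁]
      exact h.one_br_mem hi (ih (by omega))
  have hN : ∀ i, 2 ≤ i → i + 1 ≤ n → e' i ∈ N := fun i hi hin =>
    h.tailSpan_le (by omega) (hmem i hi hin)
  have heig : ∀ i, 2 ≤ i → i + 1 ≤ n →
      D (e' i) - ((i : ℂ) - 2 + b) • e' i ∈ tailSpan n e n := by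
    intro i hi
    induction i, hi using Nat.le_induction with
    | base =>
      intro _
      simpa [e₂] using hw'
    | succ i hi ih =>
      intro hin
      have h₃ := h.br_mem_last h₁ (tailSpan_anti (by omega) (hmem i hi (by omega)))
      have h₄ := h.br_central hn (h.mem le_rfl (by omega))
        (tailSpan_anti (Nat.sub_le n 1) (ih (by omega)))
      convert h₃ using 1
      rw [← e₄ i hi (by omega), e₁, hD.map_br _ (h.mem le_rfl (by omega)) _ (hN i hi (by omega))]
      simp only [map_sub, map_smul, LinearMap.sub_apply, LinearMap.smul_apply, sub_eq_zero] at h₄ ⊢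
      rw [h₄]
      push_cast
      module
  obtain ⟨h', hle⟩ : G1Frame n N e' ∧ ∀ i, 1 ≤ i → tailSpan n e' i = tailSpan n e i := by
    refine h.of_triangular hn (by simp [e₁]) (e₂ ▸ hw) e₄ e₃ fun i j hi hj hij => ?_
    obtain ⟨c, hc⟩ := exists_of_mem_tailSpan_self (h.br_mem_last
      (tailSpan_anti hi (hmem i hi (by omega))) (tailSpan_anti hj (hmem j hj (by omega))))
    have h₃ := h.br_central hn (hN i hi (by omega))
      (tailSpan_anti (Nat.sub_le n 1) (heig j hj (by omega)))
    have h₄ := h.central_br hn (hN j hj (by omega))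
      (tailSpan_anti (Nat.sub_le n 1) (heig i hi (by omega)))
    have h₅ := hD.map_br _ (hN i hi (by omega)) _ (hN j hj (by omega))
    simp only [map_sub, map_smul, LinearMap.sub_apply, LinearMap.smul_apply, sub_eq_zero] at h₃ h₄
    rw [h₃, h₄, hc, map_smul, h.derivation_last hn hD h₁ h₂] at h₅
    -- The product `c e_n` has weight `i+j-4+2b` as a bracket of eigenvectors modulo the center, but
    -- `e_n` has weight `n-4+2b`; hence `c = 0` when `i+j < n`.
    have h₆ : (c * ((n : ℂ) - (i + j))) • e n = 0 := by
      rw [← sub_eq_zero] at h₅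
      rw [← h₅]
      module
    have h₇ := h.coeff_last (by omega) h₆
    have h₈ : (n : ℂ) - (i + j) ≠ 0 := by
      rw [sub_ne_zero]
      exact_mod_cast (show n ≠ i + j by omega)
    rw [hc, (mul_eq_zero.1 h₇).resolve_right h₈, zero_smul]
  refine ⟨e', h', ?_, ?_⟩
  · rw [e₁, hle 2 (by omega)]
    exact h₁
  · have := heig 2 le_rfl (by omega)
    rw [hle n (by omega)]
    simpa using this

end G1Frame

end Extension

/-! ### Normal forms of right multiplication by `x`. -/

section NormalForm

variable {L : Type*} [AddCommGroup L] [Module ℂ L] [LeibnizAlgebra L]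
  {n : ℕ} {N : Submodule ℂ L} {e : ℕ → L} {x : L}

lemma exists_sum_of_mem_tailSpan {V : Type*} [AddCommGroup V] [Module ℂ V] {n i : ℕ} {e : ℕ → V}
    {u : V} (h : u ∈ tailSpan n e i) : ∃ β : ℕ → ℂ, u = ∑ t ∈ Finset.Icc i n, β t • e t := by
  rw [tailSpan, ← Finset.coe_Icc, Submodule.mem_span_image_finset_iff_exists_fun'] at h
  obtain ⟨β, hβ⟩ := h
  exact ⟨β, hβ.symm⟩

namespace G1Frame

/-- Bracketing with `e_1` reaches `e_3, …, e_{n-1}`. So adding some `v` to `x` clears these terms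
from `[e_1, x]`, leaving only `e_2` and `e_n`. -/
lemma exists_add_one_br (h : G1Frame n N e) {u : L} (hu : u ∈ tailSpan n e 2) :
    ∃ v ∈ tailSpan n e 2, ∃ α β : ℂ, u + br (e 1) v = α • e 2 + β • e n := by
  have hle : tailSpan n e 2 ≤
      Submodule.span ℂ {e 2, e n} ⊔ (tailSpan n e 2).map (br (e 1)) := by
    refine LeibnizAlgebra.tailSpan_le fun t ht₁ ht₂ => ?_
    rcases (show t = 2 ∨ t = n ∨ (3 ≤ t ∧ t + 1 ≤ n) by omega) with rfl | rfl | ⟨h₁, h₂⟩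
    · exact Submodule.mem_sup_left (Submodule.subset_span (by simp))
    · exact Submodule.mem_sup_left (Submodule.subset_span (by simp))
    · refine Submodule.mem_sup_right ⟨e (t - 1), mem_tailSpan (by omega) (by omega), ?_⟩
      rw [h.one_br _ (by omega) (by omega), show t - 1 + 1 = t by omega]
  obtain ⟨y, hy, z, ⟨v, hv, rfl⟩, rfl⟩ := Submodule.mem_sup.1 (hle hu)
  obtain ⟨α, β, rfl⟩ := Submodule.mem_span_pair.1 hy
  exact ⟨-v, neg_mem hv, α, β, by simp⟩

/-- The normal form of the action of `x` when it does not annihilate `N / (e_2, …, e_n)`. -/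
lemma exists_normalForm_one (h : G1Frame n N e) (hn : 7 ≤ n) (hx : IsOneExtension N x) {b : ℂ}
    (h₁ : br (e 1) x - e 1 ∈ tailSpan n e 2) (h₂ : br (e 2) x - b • e 2 ∈ tailSpan n e 3) :
    ∃ (e' : ℕ → L) (y : L), G1Frame n N e' ∧ IsOneExtension N y ∧ ∃ s p q : ℂ,
      br (e' 1) y = e' 1 + s • e' 2 + p • e' (n - 1) + q • e' n ∧ br (e' 2) y = b • e' 2 ∧
      (s = 0 ∨ b = 1) ∧ (p = 0 ∨ b = 4 - n) ∧ (q = 0 ∨ b = (5 - n) / 2) := by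
  obtain ⟨e, h, h₁, h₂⟩ := h.exists_eigenframe hn hx.derivation
    (by simpa using h₁ : br.flip x (e 1) - (1 : ℂ) • e 1 ∈ tailSpan n e 2) h₂
  simp only [LinearMap.flip_apply, one_smul] at h₁ h₂
  -- subtract an inner derivation
  obtain ⟨v, hv, s, q, hsq⟩ := h.exists_add_one_br h₁
  replace hx := hx.add (h.tailSpan_le (by omega) hv)
  obtain ⟨c, hc⟩ : ∃ c : ℂ, br (e 2) (x + v) = b • e 2 + c • e n := by
    obtain ⟨c, hc⟩ := exists_of_mem_tailSpan_self
      (add_mem h₂ (h.br_mem_last (mem_tailSpan (le_refl 2) (by omega)) hv))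
    exact ⟨c, by rw [← hc, map_add]; abel⟩
  have h₃ : br (e 1) (x + v) = e 1 + s • e 2 + q • e n := by
    rw [add_assoc, ← hsq, map_add]; abel
  -- remove the last coordinate of the image of the second vector in the resonant case
  obtain ⟨y, hy, p, c, hp, h₄, h₅⟩ : ∃ y, IsOneExtension N y ∧ ∃ p c : ℂ,
      (b ≠ 4 - n ∧ p = 0 ∨ b = 4 - n ∧ c = 0) ∧
      br (e 1) y = e 1 + s • e 2 + p • e (n - 1) + q • e n ∧
      br (e 2) y = b • e 2 + c • e n := by
    -- For `b = 4-n` the weights of `e_2` and `e_n` agree, so the shear cannot remove `c e_n`.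
    -- Adding `-c e_{n-2}` to `x` does, at the price of `-c e_{n-1}` in `[e_1, y]`: the parameter of
    -- `R_2`.
    by_cases hb : b = 4 - n
    · refine ⟨x + v + (-c) • e (n - 2), hx.add (N.smul_mem _ (h.mem (by omega) (by omega))), -c, 0,
        Or.inr ⟨hb, rfl⟩, ?_, ?_⟩
      · rw [map_add, h₃, map_smul, h.one_br _ (by omega) (by omega),
          show n - 2 + 1 = n - 1 by omega]
        abel
      · rw [map_add, hc, map_smul, h.br_add_eq 2 _ le_rfl (by omega) (by omega)]
        module
    · exact ⟨x + v, hx, 0, c, Or.inl ⟨hb, rfl⟩, by rw [h₃]; module, hc⟩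
  have h₆ : br (e n) y = ((n : ℂ) - 4 + 2 * b) • e n := by
    have := h.derivation_last hn hy.derivation (a := 1) (b := b) ?_ ?_
    · simpa using this
    · rw [LinearMap.flip_apply, h₄, one_smul, add_assoc, add_assoc, add_sub_cancel_left]
      exact add_mem (Submodule.smul_mem _ _ (mem_tailSpan le_rfl (by omega)))
        (add_mem (Submodule.smul_mem _ _ (mem_tailSpan (by omega) (by omega)))
          (Submodule.smul_mem _ _ (mem_tailSpan (by omega) (by omega))))
    · rw [LinearMap.flip_apply, h₅, add_sub_cancel_left]
      exact Submodule.smul_mem _ _ (mem_tailSpan (by omega) (by omega))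
  -- the parameters of the shear
  obtain ⟨s', hs'⟩ : ∃ s' : ℂ, s + s' * (b - 1) = 0 ∨ b = 1 := by
    by_cases hb : b = 1
    · exact ⟨0, Or.inr hb⟩
    · exact ⟨-s / (b - 1), Or.inl (by rw [div_mul_cancel₀ _ (sub_ne_zero.2 hb)]; ring)⟩
  obtain ⟨r, hr⟩ : ∃ r : ℂ, c + r * ((n : ℂ) - 4 + b) = 0 := by
    rcases hp with ⟨hb, -⟩ | ⟨-, hc⟩
    · have h0 : (n : ℂ) - 4 + b ≠ 0 := fun h0 => hb (by linear_combination h0)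
      exact ⟨-c / ((n : ℂ) - 4 + b), by rw [div_mul_cancel₀ _ h0]; ring⟩
    · exact ⟨0, by simp [hc]⟩
  set A := s + s' * (b - 1) with hA
  -- The left side is the `e_n`-coefficient of `[e'_1, y]` in the sheared basis. The factor of `p'`
  -- is the weight of `e_n` minus that of `e_1`.
  obtain ⟨p', hp'⟩ : ∃ p' : ℂ, q - p * s' + s' * c + p' * ((n : ℂ) - 5 + 2 * b) - A * r = 0 ∨
      b = (5 - n) / 2 := by
    by_cases hb : b = (5 - n) / 2
    · exact ⟨0, Or.inr hb⟩
    · have h0 : (n : ℂ) - 5 + 2 * b ≠ 0 := fun h0 => hb (by linear_combination h0 / 2)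
      exact ⟨-(q - p * s' + s' * c - A * r) / ((n : ℂ) - 5 + 2 * b), Or.inl (by
        rw [div_mul_cancel₀ _ h0]; ring)⟩
  obtain ⟨e', h', e₁, e₂, e₃, e₄⟩ := h.shear hn s' p' r
  have e₅ := e₄ n (by omega) (by omega)
  refine ⟨e', y, h', hy, A, p, q - p * s' + s' * c + p' * ((n : ℂ) - 5 + 2 * b) - A * r,
    ?_, ?_, hs', ?_, hp'⟩
  · rw [e₁, e₂, e₃, e₅]
    simp only [map_add, map_smul, LinearMap.add_apply, LinearMap.smul_apply, h₄, h₅, h₆]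
    rw [hA]
    module
  · rw [e₂]
    simp only [map_add, map_smul, LinearMap.add_apply, LinearMap.smul_apply, h₅, h₆]
    have h0 : (c + r * ((n : ℂ) - 4 + b)) • e n = 0 := by rw [hr, zero_smul]
    rw [← sub_eq_zero, ← h0]
    module
  · exact hp.imp (fun h => h.2) (fun h => h.1)

/-- The normal form of the action of `x` when it annihilates `N / (e_2, …, e_n)`. -/
lemma exists_normalForm_zero (h : G1Frame n N e) (hn : 7 ≤ n) (hx : IsOneExtension N x)
    (h₁ : br (e 1) x ∈ tailSpan n e 2) (h₂ : br (e 2) x - e 2 ∈ tailSpan n e 3) :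
    ∃ (e' : ℕ → L) (y : L), G1Frame n N e' ∧ IsOneExtension N y ∧ ∃ (s : ℂ) (β : ℕ → ℂ),
      br (e' 1) y = s • e' 2 ∧
      br (e' 2) y = e' 2 + ∑ t ∈ Finset.Icc 4 (n - 1), β t • e' t := by
  have mem₁ := h.mem le_rfl (show 1 ≤ n by omega)
  have mem₂ := h.mem (show 1 ≤ 2 by omega) (show 2 ≤ n by omega)
  obtain ⟨c, hc⟩ := exists_of_mem_tailSpan (by omega) h₂
  obtain ⟨v, hv, s, q, hsq⟩ := h.exists_add_one_br h₁
  -- Since `[e_2, c e_1] = -c e_3`, the summand `c e_1` removes `e_3` from `[e_2, x]`; `[e_2, v]` is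
  -- only a multiple of `e_n`.
  set y := x + c • e 1 + v with hy'
  have hy : IsOneExtension N y :=
    (hx.add (N.smul_mem c mem₁)).add (h.tailSpan_le (by omega) hv)
  have h₃ : br (e 1) y = s • e 2 + q • e n := by
    rw [← hsq, hy', map_add, map_add, map_smul, h.br_self mem₁, smul_zero, add_zero]
  have h₄ : br (e 2) y - e 2 ∈ tailSpan n e 4 := by
    have h₅ := tailSpan_anti (show 4 ≤ n by omega)
      (h.br_mem_last (mem_tailSpan (le_refl 2) (by omega)) hv)
    convert add_mem hc h₅ using 1
    rw [hy', map_add, map_add, map_smul, h.anti _ mem₂ _ mem₁, h.one_br 2 le_rfl (by omega)]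
    module
  obtain ⟨β, hβ⟩ := exists_sum_of_mem_tailSpan h₄
  have h₅ : br (e 2) y = e 2 + (∑ t ∈ Finset.Icc 4 (n - 1), β t • e t) + β n • e n := by
    have := Finset.sum_Icc_succ_top (show 4 ≤ (n - 1) + 1 by omega) (fun t => β t • e t)
    rw [show n - 1 + 1 = n by omega] at this
    rw [add_assoc, ← this, ← hβ]
    abel
  have h₆ : br (e n) y = (2 : ℂ) • e n := by
    have := h.derivation_last hn hy.derivation (a := 0) (b := 1) ?_ ?_
    · simpa using this
    · rw [LinearMap.flip_apply, h₃, zero_smul, sub_zero]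
      exact add_mem (Submodule.smul_mem _ _ (mem_tailSpan le_rfl (by omega)))
        (Submodule.smul_mem _ _ (mem_tailSpan (by omega) (by omega)))
    · rw [LinearMap.flip_apply, one_smul]
      exact tailSpan_anti (by omega) h₄
  -- As `e_n` has weight `2`, the shear constants solve `β_n + r = 0` for `e_2` and `q + s β_n + 2p
  -- = 0` for `e_1`.
  obtain ⟨e', h', e₁, e₂, e₃, e₄⟩ := h.shear hn 0 ((-(s * β n) - q) / 2) (-β n)
  have e₅ := e₄ n (by omega) (by omega)
  have e₆ : ∀ t ∈ Finset.Icc 4 (n - 1), β t • e' t = β t • e t := by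
    intro t ht
    rw [Finset.mem_Icc] at ht
    by_cases h0 : t = n - 1
    · rw [h0, e₃, zero_smul, add_zero]
    · rw [e₄ t (by omega) h0]
  refine ⟨e', y, h', hy, s, β, ?_, ?_⟩
  · rw [e₁, e₂]
    simp only [map_add, map_smul, LinearMap.add_apply, LinearMap.smul_apply, h₃, h₅, h₆]
    module
  · rw [Finset.sum_congr rfl e₆, e₂]
    simp only [map_add, map_smul, LinearMap.add_apply, LinearMap.smul_apply, h₅, h₆]
    module

end G1Frame

end NormalForm

/-! ### Left multiplication by `x` and the full tables. -/

section Table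

variable {L : Type*} [AddCommGroup L] [Module ℂ L] [LeibnizAlgebra L]
  {n : ℕ} {N : Submodule ℂ L} {e : ℕ → L} {x : L}

namespace G1Frame

/-- The elements of `N` annihilated by all left multiplications lie in the center of `N`. -/
lemma rightAnnihilator (h : G1Frame n N e) (hn : 7 ≤ n) {w : L} (hw : w ∈ N)
    (hann : ∀ u, br u w = 0) : w ∈ tailSpan n e (n - 1) :=
  h.mem_center hn hw (hann _) (hann _)

lemma br_add_br_swap (u a : L) : br u (br x a + br a x) = 0 := by
  rw [map_add, leibniz, leibniz]
  abel

lemma symm_mem (h : G1Frame n N e) (hn : 7 ≤ n) (hx : IsOneExtension N x) {a : L} (ha : a ∈ N) :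
    br x a + br a x ∈ tailSpan n e (n - 1) :=
  h.rightAnnihilator hn (add_mem (hx.ideal a ha x).2 (hx.ideal a ha x).1)
    fun u => br_add_br_swap u a

/-- Expand `[x,[a,b]]` by Leibniz. Since `[x,a] + [a,x]` and `[x,b] + [b,x]` are central in `N`,
left brackets with `x` inside may be replaced by negated right ones. -/
lemma symm_br (h : G1Frame n N e) (hn : 7 ≤ n) (hx : IsOneExtension N x) {a b : L} (ha : a ∈ N)
    (hb : b ∈ N) : br x (br a b) + br (br a b) x = 0 := by
  have h₁ := h.central_br hn hb (h.symm_mem hn hx ha)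
  have h₂ := h.central_br hn ha (h.symm_mem hn hx hb)
  have h₃ := h.anti a ha _ (hx.ideal b hb x).1
  have h₄ := leibniz a b x
  rw [map_add, LinearMap.add_apply, add_eq_zero_iff_eq_neg] at h₁ h₂
  rw [h₃, eq_sub_iff_add_eq] at h₄
  rw [leibniz, h₁, h₂, ← h₄]
  abel

lemma symm_three (h : G1Frame n N e) (hn : 7 ≤ n) (hx : IsOneExtension N x) {u : L}
    (hu : u ∈ tailSpan n e 3) : br x u + br u x = 0 := by
  suffices tailSpan n e 3 ≤ LinearMap.ker (br x + br.flip x) by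
    simpa using this hu
  refine LeibnizAlgebra.tailSpan_le fun t ht₁ ht₂ => ?_
  rw [LinearMap.mem_ker, LinearMap.add_apply, LinearMap.flip_apply]
  rcases (show t = n ∨ t + 1 ≤ n by omega) with rfl | ht
  · have h₁ := h.br_add_eq 2 (t - 2) le_rfl (by omega) (by omega)
    rw [even_two.neg_one_pow, one_smul] at h₁
    rw [← h₁]
    exact h.symm_br hn hx (h.mem (by omega) (by omega)) (h.mem (by omega) (by omega))
  · have h₁ := h.one_br (t - 1) (by omega) (by omega)
    rw [show t - 1 + 1 = t by omega] at h₁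
    rw [← h₁]
    exact h.symm_br hn hx (h.mem (by omega) (by omega)) (h.mem (by omega) (by omega))

lemma br_rightAnnihilator (h : G1Frame n N e) (hn : 7 ≤ n) (hx : IsOneExtension N x) {w : L}
    (hw : w ∈ tailSpan n e (n - 1)) (hann : br x w = 0) : br w x = 0 := by
  simpa [hann] using h.symm_three hn hx (tailSpan_anti (by omega) hw)

lemma br_symm (h : G1Frame n N e) (hn : 7 ≤ n) (hx : IsOneExtension N x) {a : L} (ha : a ∈ N) :
    br (br x a + br a x) x = 0 :=
  h.br_rightAnnihilator hn hx (h.symm_mem hn hx ha) (br_add_br_swap x a)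

lemma br_self_mem (h : G1Frame n N e) (hn : 7 ≤ n) (hx : IsOneExtension N x) :
    br x x ∈ tailSpan n e (n - 1) :=
  h.rightAnnihilator hn hx.self_br_mem fun u => IsOneExtension.br_br_self u

lemma br_br_self (h : G1Frame n N e) (hn : 7 ≤ n) (hx : IsOneExtension N x) :
    br (br x x) x = 0 :=
  h.br_rightAnnihilator hn hx (h.br_self_mem hn hx) (IsOneExtension.br_br_self x)

/-- The symmetric part of the action of `x` vanishes on the image of `D`; this is how it is killed
when `D` may be singular on the center. -/
lemma symm_br_right (h : G1Frame n N e) (hn : 7 ≤ n) (hx : IsOneExtension N x) {a : L}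
    (ha : a ∈ N) : br x (br a x) + br (br a x) x = 0 := by
  have h₁ := h.br_symm hn hx ha
  have h₂ := h.central_br hn ha (h.br_self_mem hn hx)
  rw [leibniz, h₂, sub_zero, ← h₁, map_add, LinearMap.add_apply]

/-- The symmetric part of the action of `x` vanishes as soon as it does on the generators. -/
lemma br_swap (h : G1Frame n N e) (hn : 7 ≤ n) (hx : IsOneExtension N x)
    (h₁ : br x (e 1) + br (e 1) x = 0) (h₂ : br x (e 2) + br (e 2) x = 0) {i : ℕ} (hi : 1 ≤ i)
    (hin : i ≤ n) : br x (e i) = -br (e i) x := by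
  rw [← add_eq_zero_iff_eq_neg]
  rcases (show i = 1 ∨ i = 2 ∨ 3 ≤ i by omega) with rfl | rfl | h3
  exacts [h₁, h₂, h.symm_three hn hx (mem_tailSpan h3 hin)]

variable {b s p q : ℂ}

lemma normalForm_one_apply (h : G1Frame n N e) (hn : 7 ≤ n) (hx : IsOneExtension N x)
    (h₁ : br (e 1) x = e 1 + s • e 2 + p • e (n - 1) + q • e n) (h₂ : br (e 2) x = b • e 2) :
    (∀ i, 2 ≤ i → i ≤ n - 2 → br (e i) x = ((i : ℂ) - 2 + b) • e i) ∧
    br (e (n - 1)) x = ((n : ℂ) - 3 + b) • e (n - 1) + s • e n ∧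
    br (e n) x = ((n : ℂ) - 4 + 2 * b) • e n := by
  have hD := hx.derivation
  have hmem : ∀ i, 1 ≤ i → i ≤ n → e i ∈ N := fun i h₁ h₂ => h.mem h₁ h₂
  have step : ∀ i, 2 ≤ i → i + 2 ≤ n → br (e i) x = ((i : ℂ) - 2 + b) • e i →
      br (e (i + 1)) x = ((i : ℂ) - 1 + b) • e (i + 1) + s • br (e 2) (e i) := by
    intro i hi hin hix
    have h₃ := h.central_br hn (hmem i (by omega) (by omega))
      (mem_tailSpan (e := e) (le_refl (n - 1)) (by omega))
    have h₄ := h.central_br hn (hmem i (by omega) (by omega))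
      (mem_tailSpan (e := e) (Nat.sub_le n 1) le_rfl)
    have h₅ := hD.map_br _ (hmem 1 le_rfl (by omega)) _ (hmem i (by omega) (by omega))
    simp only [LinearMap.flip_apply, h₁, hix, map_add, map_smul, LinearMap.add_apply,
      LinearMap.smul_apply, h₃, h₄, h.one_br i hi hin] at h₅
    rw [h₅]
    module
  have hi : ∀ i, 2 ≤ i → i ≤ n - 2 → br (e i) x = ((i : ℂ) - 2 + b) • e i := by
    intro i hi
    induction i, hi using Nat.le_induction with
    | base => intro _; rw [h₂]; norm_num
    | succ i hi ih =>
      intro hin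
      rw [step i hi (by omega) (ih (by omega)),
        h.br_add_ne 2 i le_rfl (by omega) hi (by omega) (by omega)]
      push_cast
      module
  refine ⟨hi, ?_, ?_⟩
  · have := step (n - 2) (by omega) (by omega) (hi _ (by omega) le_rfl)
    rw [h.br_add_eq 2 _ le_rfl (by omega) (by omega), show n - 2 + 1 = n - 1 by omega,
      Nat.cast_sub (by omega)] at this
    rw [this]
    push_cast
    module
  · have := h.derivation_last hn hD (a := 1) (b := b) ?_ ?_
    · simpa using this
    · rw [LinearMap.flip_apply, h₁, one_smul, add_assoc, add_assoc, add_sub_cancel_left]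
      exact add_mem (Submodule.smul_mem _ _ (mem_tailSpan le_rfl (by omega)))
        (add_mem (Submodule.smul_mem _ _ (mem_tailSpan (by omega) (by omega)))
          (Submodule.smul_mem _ _ (mem_tailSpan (by omega) (by omega))))
    · rw [LinearMap.flip_apply, h₂, sub_self]
      exact Submodule.zero_mem _

/-- The kernel of the action of `x` on the center of `N`. -/
lemma kernel_center (h : G1Frame n N e) (hn : 7 ≤ n) {μ ν : ℂ}
    (h₁ : br (e (n - 1)) x = μ • e (n - 1) + s • e n) (h₂ : br (e n) x = ν • e n) {w : L}
    (hw : w ∈ tailSpan n e (n - 1)) (hwx : br w x = 0) :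
    ∃ c d : ℂ, w = c • e (n - 1) + d • e n ∧ c * μ = 0 ∧ c * s + d * ν = 0 := by
  obtain ⟨c, d, rfl⟩ := exists_of_mem_tailSpan_pred (by omega) hw
  simp only [map_add, map_smul, LinearMap.add_apply, LinearMap.smul_apply, h₁, h₂] at hwx
  have h₃ : (c * μ) • e (n - 1) + (c * s + d * ν) • e n = 0 := by
    rw [← hwx]
    module
  have h₄ : c * μ = 0 := by
    refine h.coeff_eq_zero (show 1 ≤ n - 1 by omega) (by omega) ?_
    rw [eq_neg_of_add_eq_zero_left h₃]
    exact neg_mem (Submodule.smul_mem _ _ (mem_tailSpan (by omega) le_rfl))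
  rw [h₄, zero_smul, zero_add] at h₃
  exact ⟨c, d, rfl, h₄, h.coeff_last (by omega) h₃⟩

lemma eq_zero_of_kernel_center (h : G1Frame n N e) (hn : 7 ≤ n) {μ ν : ℂ}
    (h₁ : br (e (n - 1)) x = μ • e (n - 1) + s • e n) (h₂ : br (e n) x = ν • e n) (hμ : μ ≠ 0)
    (hν : ν ≠ 0) {w : L} (hw : w ∈ tailSpan n e (n - 1)) (hwx : br w x = 0) : w = 0 := by
  obtain ⟨c, d, rfl, h₃, h₄⟩ := h.kernel_center hn h₁ h₂ hw hwx
  have hc := (mul_eq_zero.1 h₃).resolve_right hμ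
  have hd : d = 0 := by simpa [hc, hν] using h₄
  simp [hc, hd]

lemma normalForm_one_swap (h : G1Frame n N e) (hn : 7 ≤ n) (hx : IsOneExtension N x)
    (h₁ : br (e 1) x = e 1 + s • e 2 + p • e (n - 1) + q • e n) (h₂ : br (e 2) x = b • e 2)
    {i : ℕ} (hi : 1 ≤ i) (hin : i ≤ n) : br x (e i) = -br (e i) x := by
  obtain ⟨-, h₃, h₄⟩ := h.normalForm_one_apply hn hx h₁ h₂
  have mem₁ := h.mem le_rfl (show 1 ≤ n by omega)
  have mem₂ := h.mem (show 1 ≤ 2 by omega) (show 2 ≤ n by omega)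
  -- For `b = 0` the central weights `n-3` and `n-4` are nonzero, so `D` is injective on the center.
  -- For `b ≠ 0`, `e_2` lies in the image of `D`, and then `[e_1, x]` yields `e_1`.
  by_cases hb : b = 0
  · have hn3 : (n : ℂ) - 3 + b ≠ 0 := by
      rw [hb, add_zero, sub_ne_zero]; exact_mod_cast (show n ≠ 3 by omega)
    have hn4 : (n : ℂ) - 4 + 2 * b ≠ 0 := by
      rw [hb, mul_zero, add_zero, sub_ne_zero]; exact_mod_cast (show n ≠ 4 by omega)
    exact h.br_swap hn hx
      (h.eq_zero_of_kernel_center hn h₃ h₄ hn3 hn4 (h.symm_mem hn hx mem₁) (h.br_symm hn hx mem₁))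
      (h.eq_zero_of_kernel_center hn h₃ h₄ hn3 hn4 (h.symm_mem hn hx mem₂) (h.br_symm hn hx mem₂))
      hi hin
  · have h₅ : br x (e 2) + br (e 2) x = 0 := by
      have := h.symm_br_right hn hx mem₂
      rw [h₂, map_smul, map_smul, LinearMap.smul_apply, ← smul_add] at this
      exact (smul_eq_zero.1 this).resolve_left hb
    refine h.br_swap hn hx ?_ h₅ hi hin
    have h₆ := h.symm_br_right hn hx mem₁
    have h₇ := h.symm_three hn hx (mem_tailSpan (show 3 ≤ n - 1 by omega) (by omega))
    have h₈ := h.symm_three hn hx (mem_tailSpan (show 3 ≤ n by omega) le_rfl)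
    rw [h₁] at h₆
    simp only [map_add, map_smul, LinearMap.add_apply, LinearMap.smul_apply] at h₆
    trans (0 : L) - s • (br x (e 2) + br (e 2) x) - p • (br x (e (n - 1)) + br (e (n - 1)) x) -
      q • (br x (e n) + br (e n) x)
    · rw [← h₆]
      module
    · rw [h₅, h₇, h₈]
      simp

lemma exists_basis (h : G1Frame n N e) (hx : IsOneExtension N x)
    (hdim : Module.finrank ℂ L = n + 1) :
    ∃ B : Module.Basis (Fin (n + 1)) ℂ L, B (Fin.last n) = x ∧
      ∀ i, 1 ≤ i → i ≤ n → vec B i = e i := by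
  set f : Fin (n + 1) → L := fun k => if (k : ℕ) = n then x else e (k + 1) with hf
  have hspan : ⊤ ≤ Submodule.span ℂ (Set.range f) := by
    have hxm : x ∈ Submodule.span ℂ (Set.range f) :=
      Submodule.subset_span ⟨Fin.last n, by simp [hf]⟩
    have hN : N ≤ Submodule.span ℂ (Set.range f) := by
      rw [← h.span_eq]
      refine LeibnizAlgebra.tailSpan_le fun t ht₁ ht₂ => Submodule.subset_span
        ⟨⟨t - 1, by omega⟩, ?_⟩
      simp only [hf]
      rw [if_neg (by omega), Nat.sub_add_cancel ht₁]
    intro u _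
    obtain ⟨v, hv, c, rfl⟩ := hx.exists_add u
    exact add_mem (hN hv) (Submodule.smul_mem _ _ hxm)
  have hli : LinearIndependent ℂ f :=
    linearIndependent_of_top_le_span_of_card_eq_finrank hspan (by simp [hdim])
  refine ⟨Module.Basis.mk hli hspan, by simp [hf], fun i h₁ h₂ => ?_⟩
  rw [vec, dif_pos ⟨h₁, by omega⟩, Module.Basis.mk_apply]
  simp only [hf]
  rw [if_neg (by omega), Nat.sub_add_cancel h₁]

/-- The action of `x` in the normal form that annihilates `N / (e_2, …, e_n)`; its even
coefficients vanish. -/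
lemma normalForm_zero_apply (h : G1Frame n N e) (hn : 7 ≤ n)
    (hx : IsOneExtension N x) {β : ℕ → ℂ} (h₁ : br (e 1) x = s • e 2)
    (h₂ : br (e 2) x = e 2 + ∑ t ∈ Finset.Icc 4 (n - 1), β t • e t) :
    (∀ i, 2 ≤ i → i ≤ n - 2 →
      br (e i) x = e i + ∑ t ∈ Finset.Icc (i + 2) (n - 1), β (t - i + 2) • e t) ∧
    br (e (n - 1)) x = e (n - 1) + s • e n ∧ br (e n) x = (2 : ℂ) • e n ∧
    ∀ k, 2 ≤ k → 2 * k + 3 ≤ n → β (2 * k) = 0 := by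
  have hD := hx.derivation
  have hmem : ∀ i, 1 ≤ i → i ≤ n → e i ∈ N := fun i h₁ h₂ => h.mem h₁ h₂
  have step : ∀ i, 2 ≤ i → i + 2 ≤ n →
      br (e i) x = e i + ∑ t ∈ Finset.Icc (i + 2) (n - 1), β (t - i + 2) • e t →
      br (e (i + 1)) x = e (i + 1) +
        ∑ t ∈ Finset.Icc (i + 1 + 2) (n - 1), β (t - (i + 1) + 2) • e t + s • br (e 2) (e i) := by
    intro i hi hin hix
    have h₅ := hD.map_br _ (hmem 1 le_rfl (by omega)) _ (hmem i (by omega) (by omega))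
    simp only [LinearMap.flip_apply, h₁, hix, map_add, map_smul, map_sum,
      LinearMap.smul_apply, h.one_br i hi hin] at h₅
    rw [h₅]
    have h₆ : ∑ t ∈ Finset.Icc (i + 2) (n - 1), β (t - i + 2) • br (e 1) (e t) =
        ∑ t ∈ Finset.Icc (i + 1 + 2) (n - 1), β (t - (i + 1) + 2) • e t := by
      rcases (show i + 2 = n ∨ i + 2 ≤ n - 1 by omega) with hlt | hle
      · rw [Finset.Icc_eq_empty (by omega), Finset.Icc_eq_empty (by omega)]
        simp
      · have h7 := Finset.sum_Icc_succ_top (show i + 2 ≤ (n - 2) + 1 by omega)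
          (fun t => β (t - i + 2) • br (e 1) (e t))
        rw [show n - 2 + 1 = n - 1 by omega, h.one_br_pred, smul_zero, add_zero] at h7
        rw [h7, show i + 1 + 2 = i + 2 + 1 by omega, show n - 1 = n - 2 + 1 by omega,
          ← Finset.map_add_right_Icc, Finset.sum_map]
        refine Finset.sum_congr rfl fun t ht => ?_
        rw [Finset.mem_Icc] at ht
        rw [h.one_br t (by omega) (by omega)]
        simp only [addRightEmbedding_apply]
        congr 2
        omega
    rw [h₆]
    abel
  have hi : ∀ i, 2 ≤ i → i ≤ n - 2 →
      br (e i) x = e i + ∑ t ∈ Finset.Icc (i + 2) (n - 1), β (t - i + 2) • e t := by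
    intro i hi
    induction i, hi using Nat.le_induction with
    | base =>
      intro _
      rw [h₂]
      congr 1
      refine Finset.sum_congr rfl fun t ht => ?_
      rw [Finset.mem_Icc] at ht
      rw [show t - 2 + 2 = t by omega]
    | succ i hi ih =>
      intro hin
      rw [step i hi (by omega) (ih (by omega)),
        h.br_add_ne 2 i le_rfl (by omega) hi (by omega) (by omega), smul_zero, add_zero]
  refine ⟨hi, ?_, ?_, ?_⟩
  · have := step (n - 2) (by omega) (by omega) (hi _ (by omega) le_rfl)
    rw [h.br_add_eq 2 _ le_rfl (by omega) (by omega), show n - 2 + 1 = n - 1 by omega,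
      Finset.Icc_eq_empty (by omega)] at this
    simpa using this
  · have := h.derivation_last hn hD (a := 0) (b := 1) ?_ ?_
    · simpa using this
    · rw [LinearMap.flip_apply, h₁, zero_smul, sub_zero]
      exact Submodule.smul_mem _ _ (mem_tailSpan le_rfl (by omega))
    · rw [LinearMap.flip_apply, h₂, one_smul, add_sub_cancel_left]
      refine Submodule.sum_mem _ fun t ht => ?_
      rw [Finset.mem_Icc] at ht
      exact Submodule.smul_mem _ _ (mem_tailSpan (by omega) (by omega))
  · intro k hk hkn
    -- Apply `D` to `[e_2, e_j] = 0`: `e_{2k}` in `D e_2` and `e_{n-2}` in `D e_j` both contribute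
    -- `β_{2k} e_n`, with equal signs because `2k` is even.
    set j := n - 2 * k with hj
    have h₃ := hD.map_br _ (hmem 2 (by omega) (by omega)) _
      (hmem j (by omega) (by omega))
    rw [h.br_add_ne 2 j le_rfl (by omega) (by omega) (by omega) (by omega), map_zero,
      LinearMap.flip_apply, LinearMap.flip_apply, h₂, hi j (by omega) (by omega)] at h₃
    simp only [map_add, map_sum, map_smul, LinearMap.add_apply, LinearMap.sum_apply,
      LinearMap.smul_apply] at h₃
    rw [h.br_add_ne 2 j le_rfl (by omega) (by omega) (by omega) (by omega),
      Finset.sum_eq_single (2 * k), Finset.sum_eq_single (n - 2),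
      h.br_add_eq (2 * k) j (by omega) (by omega) (by omega),
      h.br_add_eq 2 (n - 2) le_rfl (by omega) (by omega),
      show n - 2 - j + 2 = 2 * k by omega, (even_two_mul k).neg_one_pow,
      even_two.neg_one_pow] at h₃
    · have h₄ : (2 * β (2 * k)) • e n = 0 := by
        rw [h₃]
        module
      simpa using h.coeff_last (by omega) h₄
    · intro t ht htn
      rw [Finset.mem_Icc] at ht
      rw [h.br_add_ne 2 t le_rfl (by omega) (by omega) (by omega) (by omega), smul_zero]
    · intro ht
      exact absurd (Finset.mem_Icc.2 ⟨by omega, by omega⟩) ht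
    · intro t ht htn
      rw [Finset.mem_Icc] at ht
      rw [h.br_add_ne t j (by omega) (by omega) (by omega) (by omega) (by omega), smul_zero]
    · intro ht
      exact absurd (Finset.mem_Icc.2 ⟨by omega, by omega⟩) ht

end G1Frame

end Table

/-! ### Separation of the resonant values of `b`. -/

section Classification

variable {L : Type*} [AddCommGroup L] [Module ℂ L] [LeibnizAlgebra L]
  {n : ℕ} {N : Submodule ℂ L} {e : ℕ → L} {x : L}

namespace G1Frame

lemma hasTable (h : G1Frame n N e) (hodd : Odd n) (hn : 7 ≤ n) {f : ℕ → L} {c : L}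
    (hf : ∀ i, 1 ≤ i → i ≤ n → br (e i) x = f i)
    (hswap : ∀ i, 1 ≤ i → i ≤ n → br x (e i) = -br (e i) x) (hc : br x x = c) :
    HasTable n e x f c :=
  ⟨h.hasG1Table hodd hn, fun i h₁ h₂ => ⟨hf i h₁ h₂, by rw [hswap i h₁ h₂, hf i h₁ h₂]⟩, hc⟩

lemma normalForm_zero_isR1 (h : G1Frame n N e) (hodd : Odd n) (hn : 7 ≤ n)
    (hx : IsOneExtension N x) {s : ℂ} {β : ℕ → ℂ} (h₁ : br (e 1) x = s • e 2)
    (h₂ : br (e 2) x = e 2 + ∑ t ∈ Finset.Icc 4 (n - 1), β t • e t) : IsR1 n e x s β := by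
  obtain ⟨h₃, h₄, h₅, h₆⟩ := h.normalForm_zero_apply hn hx h₁ h₂
  have hker : ∀ w ∈ tailSpan n e (n - 1), br w x = 0 → w = 0 := fun w =>
    h.eq_zero_of_kernel_center hn (by rw [h₄, one_smul]) h₅ one_ne_zero two_ne_zero
  have hswap : ∀ i, 1 ≤ i → i ≤ n → br x (e i) = -br (e i) x := fun i hi hin =>
    eq_neg_of_add_eq_zero_left
      (hker _ (h.symm_mem hn hx (h.mem hi hin)) (h.br_symm hn hx (h.mem hi hin)))
  refine ⟨h₆, h.hasTable hodd hn (fun i hi hin => ?_) hswap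
    (hker _ (h.br_self_mem hn hx) (h.br_br_self hn hx))⟩
  split_ifs with c₁ c₂ c₃
  · rw [c₁, h₁]
  · exact h₃ i (by omega) c₂
  · rw [c₃, h₄]
  · rw [show i = n by omega, h₅]

lemma normalForm_one_classification (h : G1Frame n N e) (hodd : Odd n) (hn : 7 ≤ n)
    (hx : IsOneExtension N x) {s p q b : ℂ}
    (h₁ : br (e 1) x = e 1 + s • e 2 + p • e (n - 1) + q • e n) (h₂ : br (e 2) x = b • e 2)
    (hs : s = 0 ∨ b = 1) (hp : p = 0 ∨ b = 4 - n) (hq : q = 0 ∨ b = (5 - n) / 2) :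
    (∃ a : ℂ, IsR2 n e x a) ∨ (∃ δ : ℂ, IsR3 n e x δ) ∨ (∃ δ : ℂ, IsR4 n e x δ) ∨
      (∃ a : ℂ, IsR5 n e x a) ∨ (∃ a : ℂ, IsR6 n e x a) ∨ (∃ b : ℂ, IsR7 n e x b) := by
  obtain ⟨h₃, h₄, h₅⟩ := h.normalForm_one_apply hn hx h₁ h₂
  have hswap : ∀ i, 1 ≤ i → i ≤ n → br x (e i) = -br (e i) x := fun i =>
    h.normalForm_one_swap hn hx h₁ h₂
  obtain ⟨c, d, hz, hc, hd⟩ :=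
    h.kernel_center hn h₄ h₅ (h.br_self_mem hn hx) (h.br_br_self hn hx)
  have hcast : ∀ k : ℕ, k < 7 → (n : ℂ) ≠ k := fun k hk => by
    exact_mod_cast (show n ≠ k by omega)
  have hn1 := hcast 1 (by norm_num)
  have hn2 := hcast 2 (by norm_num)
  have hn3 := hcast 3 (by norm_num)
  have hn4 := hcast 4 (by norm_num)
  push_cast at hn1 hn2 hn3 hn4
  have htable : ∀ {f : ℕ → L} {z : L}, f 1 = e 1 + s • e 2 + p • e (n - 1) + q • e n →
      (∀ i, 2 ≤ i → i ≤ n - 2 → f i = ((i : ℂ) - 2 + b) • e i) →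
      f (n - 1) = ((n : ℂ) - 3 + b) • e (n - 1) + s • e n →
      f n = ((n : ℂ) - 4 + 2 * b) • e n → c • e (n - 1) + d • e n = z → HasTable n e x f z := by
    intro f z f₁ f₂ f₃ f₄ f₅
    refine h.hasTable hodd hn (fun i hi hin => ?_) hswap (hz.trans f₅)
    rcases (show i = 1 ∨ i = n ∨ i = n - 1 ∨ (2 ≤ i ∧ i ≤ n - 2) by omega) with
      rfl | rfl | rfl | ⟨h6, h7⟩
    · rw [h₁, f₁]
    · rw [h₅, f₄]
    · rw [h₄, f₃]
    · rw [h₃ i h6 h7, f₂ i h6 h7]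
  have i₁ : ¬ n = 1 := by omega
  have i₂ : ¬ n - 1 = 1 := by omega
  have i₃ : ¬ n ≤ n - 1 := by omega
  have i₄ : ¬ n ≤ n - 2 := by omega
  have i₅ : ¬ n - 1 ≤ n - 2 := by omega
  have i₆ : ¬ n = n - 1 := by omega
  have i₇ : 1 ≤ n := by omega
  -- The five special values of `b` are pairwise distinct because `n ≥ 7`, so at most one of the
  -- parameters `s, p, q, c, d` survives in each case.
  by_cases b1 : b = 1
  · have p0 : p = 0 := hp.resolve_right fun h0 => hn3 (by linear_combination h0 - b1)
    have q0 : q = 0 := hq.resolve_right fun h0 => hn3 (by linear_combination 2 * h0 - 2 * b1)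
    have c0 : c = 0 :=
      (mul_eq_zero.1 hc).resolve_right fun h0 => hn2 (by linear_combination h0 - b1)
    have d0 : d = 0 := by
      rw [c0, zero_mul, zero_add] at hd
      exact (mul_eq_zero.1 hd).resolve_right fun h0 => hn2 (by linear_combination h0 - 2 * b1)
    refine Or.inr <| Or.inr <| Or.inr <| Or.inr <| Or.inl
      ⟨s, htable (by simp [p0, q0]) (fun i h6 h7 => ?_) ?_ ?_ (by simp [c0, d0])⟩
    · rw [if_neg (by omega), if_pos h7, b1]
      module
    · rw [if_neg i₂, if_neg i₅, if_pos rfl, b1]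
      module
    · rw [if_neg i₁, if_neg i₄, if_neg i₆, b1]
      module
  have s0 : s = 0 := hs.resolve_right b1
  rw [s0, mul_zero, zero_add] at hd
  have d0 : b ≠ (4 - n) / 2 → d = 0 := fun hb =>
    (mul_eq_zero.1 hd).resolve_right fun h0 => hb (by linear_combination h0 / 2)
  have c0 : b ≠ 3 - n → c = 0 := fun hb =>
    (mul_eq_zero.1 hc).resolve_right fun h0 => hb (by linear_combination h0)
  by_cases b2 : b = 4 - n
  · have q0 : q = 0 := hq.resolve_right fun h0 => hn3 (by linear_combination 2 * b2 - 2 * h0)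
    have c0' := c0 fun h0 => one_ne_zero (α := ℂ) (by linear_combination h0 - b2)
    have d0' := d0 fun h0 => hn4 (by linear_combination 2 * b2 - 2 * h0)
    refine Or.inl ⟨p, htable (by simp [s0, q0]) (fun i h6 h7 => ?_) ?_ ?_ (by simp [c0', d0'])⟩
    · rw [if_neg (by omega), if_pos (by omega), b2]
      module
    · rw [if_neg i₂, if_pos le_rfl, b2, s0, Nat.cast_sub i₇]
      push_cast
      module
    · rw [if_neg i₁, if_neg i₃, b2]
      module
  have p0 : p = 0 := hp.resolve_right b2
  by_cases b3 : b = (5 - n) / 2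
  · have c0' := c0 fun h0 => hn1 (by linear_combination 2 * h0 - 2 * b3)
    have d0' := d0 fun h0 => one_ne_zero (α := ℂ) (by linear_combination 2 * h0 - 2 * b3)
    refine Or.inr <| Or.inr <| Or.inr <| Or.inl
      ⟨q, htable (by simp [s0, p0]) (fun i h6 h7 => ?_) ?_ ?_ (by simp [c0', d0'])⟩
    · rw [if_neg (by omega), if_pos (by omega), b3]
      module
    · rw [if_neg i₂, if_pos le_rfl, b3, s0, Nat.cast_sub i₇]
      push_cast
      module
    · rw [if_neg i₁, if_neg i₃, b3]
      module
  have q0 : q = 0 := hq.resolve_right b3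
  by_cases b4 : b = 3 - n
  · have d0' := d0 fun h0 => hn2 (by linear_combination 2 * b4 - 2 * h0)
    refine Or.inr <| Or.inl
      ⟨c, htable (by simp [s0, p0, q0]) (fun i h6 h7 => ?_) ?_ ?_ (by simp [d0'])⟩
    · rw [if_neg (by omega), if_pos h7, b4]
      module
    · rw [if_neg i₂, if_neg i₅, if_pos rfl, b4, s0]
      module
    · rw [if_neg i₁, if_neg i₄, if_neg i₆, b4]
      module
  by_cases b5 : b = (4 - n) / 2
  · refine Or.inr <| Or.inr <| Or.inl
      ⟨d, htable (by simp [s0, p0, q0]) (fun i h6 h7 => ?_) ?_ ?_ (by simp [c0 b4])⟩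
    · rw [if_neg (by omega), if_pos (by omega), b5]
      module
    · rw [if_neg i₂, if_pos le_rfl, b5, s0, Nat.cast_sub i₇]
      push_cast
      module
    · rw [if_neg i₁, if_neg i₃, b5]
      module
  · refine Or.inr <| Or.inr <| Or.inr <| Or.inr <| Or.inr
      ⟨b, by simp [b1, b2, b3, b4, b5], htable (by simp [s0, p0, q0]) (fun i h6 h7 => ?_) ?_ ?_
        (by simp [c0 b4, d0 b5])⟩
    · rw [if_neg (by omega), if_pos (by omega)]
    · rw [if_neg i₂, if_pos le_rfl, s0, Nat.cast_sub i₇]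
      push_cast
      module
    · rw [if_neg i₁, if_neg i₃]

end G1Frame

end Classification

end LeibnizAlgebra

/-! ### Assembly: the weights `a`, `b` decide the case. -/

theorem mainTheorem1 (n : ℕ) (hodd : Odd n) (hn : 5 < n)
    {R : Type*} [AddCommGroup R] [Module ℂ R] [FiniteDimensional ℂ R] [LeibnizAlgebra R]
    (hsolv : LeibnizAlgebra.IsSolvableAlgebra R)
    (N Q : Submodule ℂ R) (hN : LeibnizAlgebra.IsNilradical N)
    (hG : LeibnizAlgebra.IsG1 n N) (hNQ : IsCompl N Q) (hQ : Module.finrank ℂ Q = 1) :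
    ∃ B : Module.Basis (Fin (n + 1)) ℂ R, ∃ (e : ℕ → R) (x : R),
      e = LeibnizAlgebra.vec B ∧ x = B (Fin.last n) ∧
      ((∃ (a₂ : ℂ) (b : ℕ → ℂ), LeibnizAlgebra.IsR1 n e x a₂ b) ∨
       (∃ a : ℂ, LeibnizAlgebra.IsR2 n e x a) ∨
       (∃ δ : ℂ, LeibnizAlgebra.IsR3 n e x δ) ∨
       (∃ δ : ℂ, LeibnizAlgebra.IsR4 n e x δ) ∨
       (∃ a : ℂ, LeibnizAlgebra.IsR5 n e x a) ∨
       (∃ a₂ : ℂ, LeibnizAlgebra.IsR6 n e x a₂) ∨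
       (∃ b₂ : ℂ, LeibnizAlgebra.IsR7 n e x b₂)) := by
  open LeibnizAlgebra in
  have hn7 : 7 ≤ n := by
    obtain ⟨m, rfl⟩ := hodd
    omega
  obtain ⟨e, h⟩ := hG.exists_frame hodd hn7
  have hdim : Module.finrank ℂ R = n + 1 := by
    obtain ⟨b, -⟩ := hG
    rw [← Submodule.finrank_add_eq_of_isCompl hNQ, hQ, Module.finrank_eq_card_basis b,
      Fintype.card_fin]
  obtain ⟨x, hx⟩ : ∃ x, IsOneExtension N x := by
    obtain ⟨x, hx0, hx⟩ := finrank_eq_one_iff'.1 hQ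
    refine ⟨x, hN.1.1, fun hxN => hx0 ?_, fun u => ?_⟩
    · exact Subtype.ext (Submodule.disjoint_def.1 hNQ.disjoint _ hxN x.2)
    · obtain ⟨v, hv, w, hw, rfl⟩ := Submodule.mem_sup.1
        (hNQ.sup_eq_top ▸ Submodule.mem_top (x := u))
      obtain ⟨c, hc⟩ := hx ⟨w, hw⟩
      exact ⟨v, hv, c, by
        rw [show w = c • (x : R) from (congrArg Subtype.val hc).symm]⟩
  -- pass to a basis of the whole algebra
  have finish : ∀ (e' : ℕ → R) (y : R), G1Frame n N e' → IsOneExtension N y →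
      ∃ B : Module.Basis (Fin (n + 1)) ℂ R, B (Fin.last n) = y ∧ G1Frame n N (vec B) ∧
        ∀ i, 1 ≤ i → i ≤ n → vec B i = e' i := by
    intro e' y h' hy
    obtain ⟨B, hB, hvec⟩ := h'.exists_basis hy hdim
    exact ⟨B, hB, h'.congr hn7 hvec, hvec⟩
  obtain ⟨a, ha⟩ := h.exists_one (by omega) (hx.ideal _ (h.mem le_rfl (by omega)) x).1
  obtain ⟨b, hb⟩ := h.derivation_two hn7 hx.derivation
  rw [LinearMap.flip_apply] at hb
  by_cases ha0 : a = 0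
  · by_cases hb0 : b = 0
    · rw [ha0, zero_smul, sub_zero] at ha
      rw [hb0, zero_smul, sub_zero] at hb
      -- Maximality of `N` among nilpotent ideals would force `N = R`, although `x ∉ N`.
      have htop := hN.2 (y := ⊤)
        ⟨fun _ _ _ => ⟨Submodule.mem_top, Submodule.mem_top⟩, h.isNilpotentIdeal_top hn7 hx ha hb⟩
        le_top
      exact absurd (htop Submodule.mem_top) hx.notMem
    · obtain ⟨e', y, h', hy, s, β, h₁, h₂⟩ := h.exists_normalForm_zero hn7
        (hx.smul (inv_ne_zero hb0))
        (by
          rw [ha0, zero_smul, sub_zero] at ha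
          rw [map_smul]
          exact Submodule.smul_mem _ _ ha)
        (by simpa [smul_sub, smul_smul, hb0] using Submodule.smul_mem _ b⁻¹ hb)
      obtain ⟨B, rfl, hB, hvec⟩ := finish e' y h' hy
      refine ⟨B, _, _, rfl, rfl, Or.inl ⟨s, β, hB.normalForm_zero_isR1 hodd hn7 hy ?_ ?_⟩⟩
      · rw [hvec 1 le_rfl (by omega), hvec 2 (by omega) (by omega), h₁]
      · rw [hvec 2 (by omega) (by omega), h₂]
        congr 1
        refine Finset.sum_congr rfl fun t ht => ?_
        rw [Finset.mem_Icc] at ht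
        rw [hvec t (by omega) (by omega)]
  · obtain ⟨e', y, h', hy, s, p, q, h₁, h₂, hs, hp, hq⟩ := h.exists_normalForm_one hn7
      (hx.smul (inv_ne_zero ha0)) (b := a⁻¹ * b)
      (by simpa [smul_sub, smul_smul, ha0] using Submodule.smul_mem _ a⁻¹ ha)
      (by simpa [smul_sub, smul_smul] using Submodule.smul_mem _ a⁻¹ hb)
    obtain ⟨B, rfl, hB, hvec⟩ := finish e' y h' hy
    refine ⟨B, _, _, rfl, rfl,
      Or.inr (hB.normalForm_one_classification hodd hn7 hy ?_ ?_ hs hp hq)⟩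
    · rw [hvec 1 le_rfl (by omega), hvec 2 (by omega) (by omega),
        hvec (n - 1) (by omega) (by omega), hvec n (by omega) le_rfl, h₁]
    · rw [hvec 2 (by omega) (by omega), h₂]
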